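/- Let $R$ be an associative ring with identity; "module" means left $R$-module, and complexes are cochain complexes $X=(\cdots\to X^{i}\xrightarrow{d_X^{i}}X^{i+1}\to\cdots)$ of modules indexed by $\mathbb Z$. A module is also regarded as a complex concentrated in degree $0$. A short exact sequence $0\to A\xrightarrow{f} B\xrightarrow{g} C\to 0$ is *pure exact* if $0\to M\otimes_R A\to M\otimes_R B\to M\otimes_R C\to 0$ is exact for every right $R$-module $M$; then $f$ is called *pure monic* and $g$ *pure epic*. A module is *pure projective* if it is projective with respect to pure exact sequences. A complex $X$ is *pure exact at $n$* if each of $d_X^{n-1}$, $d_X^{n}$ is the composite of a pure epic map followed by a pure monic map, and $0\to\operatorname{Ker}d_X^{n}\to X^{n}\to\operatorname{Coker}d_X^{n-1}\to 0$ (with the canonical maps) is pure exact; it is *pure exact* if it is pure exact at every $n$. Let $\inf_p X$ and $\sup_p X$ be the infimum and the supremum in $[-\infty,\infty]$ of $\{n\in\mathbb Z\mid X\text{ is not pure exact at }n\}$ (so $\inf_pX=\infty$ and $\sup_pX=-\infty$ if $X$ is pure exact). A cochain map is a *pure quasi-isomorphism* if its mapping cone is pure exact. The *pure derived category* $\mathbf{D}_{pur}(R)$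 is the Verdier quotient of the homotopy category $\mathbf K(R)$ of complexes by the pure exact complexes, and $\mathbf{D}^b_{pur}(R)$ consists of the complexes that are isomorphic in $\mathbf{D}_{pur}(R)$ to a bounded complex. A *pure projective resolution* of $X$ is a pure quasi-isomorphism $P\to X$ with all $P^i$ pure projective and such that the total Hom complex $\operatorname{Hom}_R(P,E)$ is a pure exact complex of abelian groups for every pure exact complex $E$ of modules. Write $\operatorname{ppd}_R X\le n$ if $X$ has a pure projective resolution $P\to X$ with $P^{i}=0$ for all $i<-n$. For $X\in\mathbf{D}^b_{pur}(R)$ (such $X$ has a pure projective resolution $P\to X$, and the following does not depend on its choice, up to isomorphism) and any complex $Y$, put $\operatorname{Pext}^i_R(X,Y)=H^i\operatorname{Hom}_R(P,Y)$. A complex is *contractible* if its identity map is homotopic to zero. **Theorem.** For any $X\in\mathbf{D}^b_{pur}(R)$ and $n\in\mathbb Z$, the following statements are equivalent. 1. $\operatorname{ppd}_R X\le n$. 2. $\inf_p X\ge -n$, and for every pure projective resolution $P'\to X$ the module $\operatorname{Coker}d_{P'}^{-n-1}$ is pure projective. 3. For every pure projective resolution $P'\to X$ there is an isomorphism of complexes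 $P'\cong P_1\oplus P_2$ with $P_1^{i}=0$ for all $i<-n$ and $P_2$ contractible. 4. $\operatorname{Pext}^i_R(X,Y)=0$ for every $Y\in\mathbf{D}_{pur}(R)$ and every integer $i>n+\sup_p Y$. 5. $\inf_p X\ge -n$, and $\operatorname{Pext}^{n+1}_R(X,N)=0$ for every module $N$. -/

import Mathlib

open CategoryTheory CategoryTheory.Limits
open scoped TensorProduct

universe w v u

noncomputable section

namespace PureDerived

/-! ## Tensor products of a right and a left module over an arbitrary ring -/

section Tensor

variable (R : Type w) [Ring R]

/-- The subgroup of `M ⊗[ℤ] A` generated by all `(m r) ⊗ a - m ⊗ (r a)`, for a right `R`-module `M`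
(a module over the opposite ring) and a left `R`-module `A`. -/
def balancedRel (M : Type*) [AddCommGroup M] [Module Rᵐᵒᵖ M]
    (A : Type*) [AddCommGroup A] [Module R A] : AddSubgroup (M ⊗[ℤ] A) :=
  AddSubgroup.closure
    {t | ∃ (m : M) (r : R) (a : A), t = (MulOpposite.op r • m) ⊗ₜ[ℤ] a - m ⊗ₜ[ℤ] (r • a)}

/-- The abelian group `M ⊗_R A`, for a right `R`-module `M` and a left `R`-module `A`. -/
abbrev RTensor (M : Type*) [AddCommGroup M] [Module Rᵐᵒᵖ M]
    (A : Type*) [AddCommGroup A] [Module R A] : Type _ :=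
  (M ⊗[ℤ] A) ⧸ balancedRel R M A

variable {R}

lemma balancedRel_le_comap (M : Type*) [AddCommGroup M] [Module Rᵐᵒᵖ M]
    {A B : Type*} [AddCommGroup A] [Module R A] [AddCommGroup B] [Module R B] (f : A →ₗ[R] B) :
    balancedRel R M A ≤
      (balancedRel R M B).comap
        (LinearMap.lTensor M f.toAddMonoidHom.toIntLinearMap).toAddMonoidHom := by
  refine (AddSubgroup.closure_le _).2 ?_
  rintro _ ⟨m, r, a, rfl⟩
  refine AddSubgroup.subset_closure ⟨m, r, f a, ?_⟩
  simp

/-- The homomorphism `M ⊗_R f : M ⊗_R A → M ⊗_R B` induced by an `R`-linear map `f : A → B`;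
it sends the class of `m ⊗ a` to the class of `m ⊗ f a`. -/
def RTensor.map (M : Type*) [AddCommGroup M] [Module Rᵐᵒᵖ M]
    {A B : Type*} [AddCommGroup A] [Module R A] [AddCommGroup B] [Module R B] (f : A →ₗ[R] B) :
    RTensor R M A →+ RTensor R M B :=
  QuotientAddGroup.map (balancedRel R M A) (balancedRel R M B)
    (LinearMap.lTensor M f.toAddMonoidHom.toIntLinearMap).toAddMonoidHom (balancedRel_le_comap M f)

end Tensor

/-! ## Purity -/

variable {R : Type w} [Ring R]

/-- A short exact sequence `0 → A → B → C → 0` of left `R`-modules is pure exact if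
`0 → M ⊗_R A → M ⊗_R B → M ⊗_R C → 0` is exact for every right `R`-module `M`. -/
def IsPureShortExact (S : ShortComplex (ModuleCat.{v} R)) : Prop :=
  S.ShortExact ∧
    ∀ (M : Type (max w v)) [AddCommGroup M] [Module Rᵐᵒᵖ M],
      Function.Injective (RTensor.map M S.f.hom) ∧
      Function.Exact (RTensor.map M S.f.hom) (RTensor.map M S.g.hom) ∧
      Function.Surjective (RTensor.map M S.g.hom)

/-- `f` is pure monic: it is the first map of a pure exact sequence `0 → A → B → C → 0`. -/
def IsPureMono {A B : ModuleCat.{v} R} (f : A ⟶ B) : Prop :=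
  ∃ (C : ModuleCat.{v} R) (g : B ⟶ C) (h : f ≫ g = 0), IsPureShortExact (ShortComplex.mk f g h)

/-- `g` is pure epic: it is the second map of a pure exact sequence `0 → A → B → C → 0`. -/
def IsPureEpi {B C : ModuleCat.{v} R} (g : B ⟶ C) : Prop :=
  ∃ (A : ModuleCat.{v} R) (f : A ⟶ B) (h : f ≫ g = 0), IsPureShortExact (ShortComplex.mk f g h)

/-- `d` decomposes as a pure epic map followed by a pure monic one. -/
def HasPureDecomposition {A B : ModuleCat.{v} R} (d : A ⟶ B) : Prop :=
  ∃ (D : ModuleCat.{v} R) (p : A ⟶ D) (j : D ⟶ B), IsPureEpi p ∧ IsPureMono j ∧ p ≫ j = d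

/-- A complex `X` is pure exact at `n` if both `d^{n-1}` and `d^n` decompose as a pure epic map
followed by a pure monic one, and `0 → Ker d^n → X^n → Coker d^{n-1} → 0` is pure exact. -/
def IsPureExactAt (X : CochainComplex (ModuleCat.{v} R) ℤ) (n : ℤ) : Prop :=
  HasPureDecomposition (X.d (n - 1) n) ∧ HasPureDecomposition (X.d n (n + 1)) ∧
    ∃ h : kernel.ι (X.d n (n + 1)) ≫ cokernel.π (X.d (n - 1) n) = 0,
      IsPureShortExact
        (ShortComplex.mk (kernel.ι (X.d n (n + 1))) (cokernel.π (X.d (n - 1) n)) h)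

/-- A complex is pure exact if it is pure exact at every `n`. -/
def IsPureExact (X : CochainComplex (ModuleCat.{v} R) ℤ) : Prop :=
  ∀ n : ℤ, IsPureExactAt X n

/-- A module is pure projective if it is projective with respect to pure exact sequences. -/
def IsPureProjective (M : ModuleCat.{v} R) : Prop :=
  ∀ S : ShortComplex (ModuleCat.{v} R), IsPureShortExact S →
    ∀ g : M ⟶ S.X₃, ∃ h : M ⟶ S.X₂, h ≫ S.g = g

/-- A cochain map is a pure quasi-isomorphism if its mapping cone is pure exact. -/
def IsPureQuasiIso {X Y : CochainComplex (ModuleCat.{v} R) ℤ} (f : X ⟶ Y) : Prop :=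
  IsPureExact (CochainComplex.mappingCone f)

/-- `inf_p X`, the infimum in `[-∞, ∞]` of the degrees at which `X` is not pure exact. -/
def infP (X : CochainComplex (ModuleCat.{v} R) ℤ) : EReal :=
  sInf {x : EReal | ∃ n : ℤ, ¬ IsPureExactAt X n ∧ x = ((n : ℝ) : EReal)}

/-- `sup_p X`, the supremum in `[-∞, ∞]` of the degrees at which `X` is not pure exact. -/
def supP (X : CochainComplex (ModuleCat.{v} R) ℤ) : EReal :=
  sSup {x : EReal | ∃ n : ℤ, ¬ IsPureExactAt X n ∧ x = ((n : ℝ) : EReal)}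

/-! ## The pure derived category -/

variable (R) in
/-- The pure exact complexes, as a class of objects of the homotopy category `K(R)`. -/
def pureExactComplexes :
    ObjectProperty (HomotopyCategory (ModuleCat.{v} R) (ComplexShape.up ℤ)) :=
  fun X => IsPureExact X.as

variable (R) in
/-- The pure derived category `D_pur(R)`, the Verdier quotient of `K(R)` by the pure exact
complexes: the localization of `K(R)` at all morphisms with a pure exact cone. -/
abbrev DPur : Type _ := (pureExactComplexes.{w, v} R).trW.Localization

variable (R) in
/-- The canonical functor from complexes to the pure derived category. -/
def toDPur : CochainComplex (ModuleCat.{v} R) ℤ ⥤ DPur.{w, v} R :=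
  HomotopyCategory.quotient (ModuleCat.{v} R) (ComplexShape.up ℤ) ⋙
    (pureExactComplexes.{w, v} R).trW.Q

/-- `X^i = 0` for `i ≪ 0` and for `i ≫ 0`. -/
def IsBounded (X : CochainComplex (ModuleCat.{v} R) ℤ) : Prop :=
  ∃ a b : ℤ, ∀ i : ℤ, (i < a ∨ b < i) → IsZero (X.X i)

/-- `X` belongs to `D^b_pur(R)`, as a full subcategory of `D_pur(R)` closed under isomorphisms:
`X` is isomorphic in `D_pur(R)` to a bounded complex (for instance, `X` is bounded). -/
def InDbPur (X : CochainComplex (ModuleCat.{v} R) ℤ) : Prop :=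
  ∃ B : CochainComplex (ModuleCat.{v} R) ℤ, IsBounded B ∧
    Nonempty ((toDPur R).obj X ≅ (toDPur R).obj B)

/-! ## Resolutions, dimension and derived functors -/

/-- The total complex `Hom_R(X, Y)` of abelian groups: in degree `n` it is
`∏ i, Hom_R(X^i, Y^{i+n})`, with differential `φ ↦ d_Y ∘ φ - (-1)^n φ ∘ d_X`. -/
def homComplex (X Y : CochainComplex (ModuleCat.{v} R) ℤ) : CochainComplex (ModuleCat.{v} ℤ) ℤ where
  X n := ModuleCat.of ℤ (CochainComplex.HomComplex.Cochain X Y n)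
  d i j := ModuleCat.ofHom (CochainComplex.HomComplex.δ_hom ℤ X Y i j)
  shape i j hij := by
    exact ModuleCat.hom_ext (LinearMap.ext fun z => CochainComplex.HomComplex.δ_shape i j hij z)
  d_comp_d' i j k _ _ := by
    exact ModuleCat.hom_ext (LinearMap.ext fun z => CochainComplex.HomComplex.δ_δ i j k z)

/-- A pure projective resolution of `X`: a pure quasi-isomorphism `f : P ⟶ X` from a complex of pure
projective modules such that `Hom_R(P, -)` takes pure exact complexes of `R`-modules to pure exact
complexes of abelian groups. -/
structure PureProjRes (X : CochainComplex (ModuleCat.{v} R) ℤ) where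
  /-- the resolving complex -/
  P : CochainComplex (ModuleCat.{v} R) ℤ
  /-- the resolving map -/
  f : P ⟶ X
  isPureQuasiIso : IsPureQuasiIso f
  isPureProjective : ∀ i : ℤ, IsPureProjective (P.X i)
  preserves : ∀ E : CochainComplex (ModuleCat.{v} R) ℤ, IsPureExact E → IsPureExact (homComplex P E)

/-- `ppd X ≤ n`: some pure projective resolution `P` of `X` has `P^i = 0` for all `i < -n`. -/
def PPDLE (X : CochainComplex (ModuleCat.{v} R) ℤ) (n : ℤ) : Prop :=
  ∃ ρ : PureProjRes X, ∀ i : ℤ, i < -n → IsZero (ρ.P.X i)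

open Classical in
/-- `Pext^i(X, Y) = H^i Hom_R(P, Y)`, where `P` is a pure projective resolution of `X` (the result
does not depend on the choice, up to isomorphism). The value `0` is assigned if `X` has no
pure projective resolution, which does not happen for `X` in `D^b_pur(R)`. -/
def Pext (i : ℤ) (X Y : CochainComplex (ModuleCat.{v} R) ℤ) : ModuleCat.{v} ℤ :=
  if h : Nonempty (PureProjRes X) then (homComplex h.some.P Y).homology i else ModuleCat.of ℤ PUnit

/-- A complex is contractible if its identity map is homotopic to zero. -/
def IsContractible (X : CochainComplex (ModuleCat.{v} R) ℤ) : Prop :=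
  Nonempty (Homotopy (𝟙 X) 0)

/-- A module, regarded as a complex concentrated in degree `0`. -/
def stalk (N : ModuleCat.{v} R) : CochainComplex (ModuleCat.{v} R) ℤ :=
  (HomologicalComplex.single (ModuleCat.{v} R) (ComplexShape.up ℤ) 0).obj N

end PureDerived

end

/-! A short exact sequence is pure exact iff finite systems of linear equations solvable modulo
its kernel lift, that is, iff `Hom(F, -)` keeps it exact for all finitely presented `F`. In terms
of such systems, pure exactness of a complex at `k` follows from exactness of `Hom(F, -)` at `k`,
`k + 1` and `k + 2`, while pure exactness in all degrees is also exactness of `M ⊗ -` in all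
degrees. Exactness of `M ⊗ -` in all degrees less than `-n` is equivalent to `inf_p ≥ -n` and is
transported by pure quasi-isomorphisms.

Pure projective resolutions are pure K-projective, so `Pext` consists of morphisms in the homotopy
category. If `P` vanishes in degrees less than `-n`, a cocycle `P → Y[i]` with `i > n + sup_p Y`
only sees the part of `Y` where `Hom(F, Y)` is exact, and it becomes a coboundary after passing to
the pure exact quotient of `Y` by a truncation. Conversely, `Pext` into the modules `Coker d^j`
bounds `inf_p` from below and makes `Coker d^{-n-1}` pure projective. Then the quotient of `P` by
everything in degrees less than `-n` and the coboundaries in degree `-n` splits off, and its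
complement is pure exact and pure K-projective, hence contractible. -/

noncomputable section

namespace PureDerived

/-! ### Finite linear systems -/

section Systems

variable {R : Type w} [Ring R] {A B C : Type*} [AddCommGroup A] [Module R A] [AddCommGroup B]
  [Module R B] [AddCommGroup C] [Module R C] {f : A →ₗ[R] B} {g : B →ₗ[R] C}

/-- Every solution in `C` of a finite homogeneous linear system lifts along `g` to a solution
in `B`; this characterises the pure epimorphisms. -/
def LiftsSystems (g : B →ₗ[R] C) : Prop :=
  ∀ (m n : ℕ) (a : Fin m → Fin n → R) (c : Fin n → C), (∀ i, ∑ j, a i j • c j = 0) →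
    ∃ b : Fin n → B, (∀ i, ∑ j, a i j • b j = 0) ∧ ∀ j, g (b j) = c j

/-- Every finite inhomogeneous linear system with constants in `A` which is solvable in `B` is
solvable in `A`; this characterises the pure monomorphisms. -/
def ReflectsSystems (f : A →ₗ[R] B) : Prop :=
  ∀ (m n : ℕ) (a : Fin m → Fin n → R) (x : Fin m → A) (b : Fin n → B),
    (∀ i, f (x i) = ∑ j, a i j • b j) → ∃ y : Fin n → A, ∀ i, x i = ∑ j, a i j • y j

lemma LiftsSystems.surjective (hg : LiftsSystems g) : Function.Surjective g := fun c => by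
  obtain ⟨b, -, hb⟩ := hg 0 1 (fun _ _ => 0) (fun _ => c) (fun i => i.elim0)
  exact ⟨b 0, hb 0⟩

lemma ReflectsSystems.injective (hf : ReflectsSystems f) : Function.Injective f := by
  refine (injective_iff_map_eq_zero f).2 fun x hx => ?_
  obtain ⟨y, hy⟩ := hf 1 0 (fun _ _ => 0) (fun _ => x) (fun i => i.elim0) (by simpa using hx)
  simpa using hy 0

lemma ReflectsSystems.liftsSystems (hf : ReflectsSystems f) (h : Function.Exact f g)
    (hg : Function.Surjective g) : LiftsSystems g := by
  intro m n a c hc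
  choose b hb using fun j => hg (c j)
  have hx : ∀ i, ∃ x, f x = ∑ j, a i j • b j := fun i => (h _).1 (by simp [hb, hc])
  choose x hx using hx
  obtain ⟨y, hy⟩ := hf m n a x b hx
  refine ⟨fun j => b j - f (y j), fun i => ?_, fun j => ?_⟩
  · simp only [smul_sub, Finset.sum_sub_distrib]
    rw [← hx, hy]
    simp
  · simp [hb, h.apply_apply_eq_zero]

lemma LiftsSystems.reflectsSystems (hg : LiftsSystems g) (h : Function.Exact f g)
    (hf : Function.Injective f) : ReflectsSystems f := by
  intro m n a x b hx
  obtain ⟨b', hb', hgb⟩ := hg m n a (fun j => g (b j)) fun i => by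
    simpa [h.apply_apply_eq_zero] using (congrArg g (hx i)).symm
  have hy : ∀ j, ∃ y, f y = b j - b' j := fun j => (h _).1 (by simp [hgb])
  choose y hy using hy
  exact ⟨y, fun i => hf (by simp [hy, smul_sub, Finset.sum_sub_distrib, hb', hx])⟩

lemma ReflectsSystems.finset (hf : ReflectsSystems f) {ι κ : Type*} (s : Finset ι) (t : Finset κ)
    (a : ι → κ → R) (x : ι → A) (b : κ → B)
    (h : ∀ i ∈ s, f (x i) = ∑ j ∈ t, a i j • b j) :
    ∃ y : κ → A, ∀ i ∈ s, x i = ∑ j ∈ t, a i j • y j := by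
  classical
  obtain ⟨y, hy⟩ := hf s.card t.card
    (fun i j => a (s.equivFin.symm i) (t.equivFin.symm j)) (fun i => x (s.equivFin.symm i))
    (fun j => b (t.equivFin.symm j)) fun i => by
      rw [h _ (s.equivFin.symm i).2, ← Finset.sum_coe_sort]
      exact (Equiv.sum_comp t.equivFin.symm fun j : t => a (s.equivFin.symm i) j • b j).symm
  refine ⟨fun j => if hj : j ∈ t then y (t.equivFin ⟨j, hj⟩) else 0, fun i hi => ?_⟩
  rw [← Finset.sum_coe_sort, ← Equiv.sum_comp t.equivFin.symm]
  simpa using hy (s.equivFin ⟨i, hi⟩)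

end Systems

/-! ### Tensor products over a noncommutative ring -/

namespace RTensor

variable {R : Type w} [Ring R] {M A B C : Type*} [AddCommGroup M] [Module Rᵐᵒᵖ M]
  [AddCommGroup A] [Module R A] [AddCommGroup B] [Module R B] [AddCommGroup C] [Module R C]

/-- The homomorphism out of `M ⊗_R A` induced by a balanced biadditive map. -/
def lift {Q : Type*} [AddCommGroup Q] (φ : M →+ A →+ Q)
    (hφ : ∀ m (r : R) a, φ (MulOpposite.op r • m) a = φ m (r • a)) : RTensor R M A →+ Q :=
  QuotientAddGroup.lift _ (TensorProduct.liftAddHom φ fun r m a => by simp) <| by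
    refine (AddSubgroup.closure_le _).2 ?_
    rintro _ ⟨m, r, a, rfl⟩
    simp [hφ, AddMonoidHom.mem_ker]

variable (R M A) in
/-- The universal biadditive map, `m` and `a` going to the class `m ⊗ a` in `M ⊗_R A`. -/
def mk : M →+ A →+ RTensor R M A :=
  AddMonoidHom.mk' (fun m => (QuotientAddGroup.mk' (balancedRel R M A)).comp
    (TensorProduct.mk ℤ M A m).toAddMonoidHom) fun m m' => by
      ext a
      simp

lemma map_mk (f : A →ₗ[R] B) (m : M) (a : A) :
    map M f (mk R M A m a) = mk R M B m (f a) := rfl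

lemma mk_smul (m : M) (r : Rᵐᵒᵖ) (a : A) :
    mk R M A m (r.unop • a) = mk R M A (r • m) a := by
  refine (QuotientAddGroup.eq_iff_sub_mem.2 ?_).symm
  exact AddSubgroup.subset_closure ⟨m, r.unop, a, rfl⟩

lemma map_surjective {g : B →ₗ[R] C} (hg : Function.Surjective g) :
    Function.Surjective (map M g) := by
  have h := LinearMap.lTensor_surjective M (g := g.toAddMonoidHom.toIntLinearMap) hg
  intro t
  obtain ⟨t, rfl⟩ := QuotientAddGroup.mk_surjective t
  obtain ⟨s, rfl⟩ := h t
  exact ⟨QuotientAddGroup.mk s, rfl⟩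

lemma balancedRel_le_map {g : B →ₗ[R] C} (hg : Function.Surjective g) :
    balancedRel R M C ≤ (balancedRel R M B).map
      (LinearMap.lTensor M g.toAddMonoidHom.toIntLinearMap).toAddMonoidHom := by
  refine (AddSubgroup.closure_le _).2 ?_
  rintro _ ⟨m, r, c, rfl⟩
  obtain ⟨b, rfl⟩ := hg c
  exact ⟨_, AddSubgroup.subset_closure ⟨m, r, b, rfl⟩, by simp⟩

lemma map_exact {f : A →ₗ[R] B} {g : B →ₗ[R] C} (h : Function.Exact f g)
    (hg : Function.Surjective g) : Function.Exact (map M f) (map M g) := by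
  have hexact := lTensor_exact M (f := f.toAddMonoidHom.toIntLinearMap)
    (g := g.toAddMonoidHom.toIntLinearMap) h hg
  intro t
  obtain ⟨t, rfl⟩ := QuotientAddGroup.mk_surjective t
  constructor
  · intro ht
    obtain ⟨s, hs, hst⟩ := balancedRel_le_map hg ((QuotientAddGroup.eq_zero_iff _).1 ht)
    obtain ⟨u, hu⟩ := (hexact (t - s)).1 (by rw [map_sub, sub_eq_zero]; exact hst.symm)
    refine ⟨QuotientAddGroup.mk u, QuotientAddGroup.eq_iff_sub_mem.2 ?_⟩
    have : LinearMap.lTensor M f.toAddMonoidHom.toIntLinearMap u - t = -s := by rw [hu]; abel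
    exact this ▸ neg_mem hs
  · rintro ⟨s, hs⟩
    obtain ⟨s, rfl⟩ := QuotientAddGroup.mk_surjective s
    rw [← hs]
    exact congrArg QuotientAddGroup.mk (hexact.apply_apply_eq_zero s)

variable {I : Type*}

/-- The tuple with entries `sᵢ a`, for a tuple `s` of scalars. -/
def coordSMul : (I →₀ Rᵐᵒᵖ) →+ A →+ (I →₀ A) :=
  Finsupp.liftAddHom fun i => AddMonoidHom.mk'
    (fun r => (Finsupp.singleAddHom i).comp (DistribSMul.toAddMonoidHom A r.unop))
    fun r r' => by ext; simp [add_smul]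

lemma coordSMul_apply (s : I →₀ Rᵐᵒᵖ) (a : A) (i : I) :
    coordSMul (A := A) s a i = (s i).unop • a := by
  classical
  induction s using Finsupp.induction_linear with
  | zero => simp
  | add s t hs ht => simp [hs, ht, add_smul]
  | single j r => by_cases h : j = i <;> simp [coordSMul, h]

/-- The element `∑ eᵢ ⊗ xᵢ` of `M ⊗_R A`, as a function of the tuple `x`. -/
def combination (e : I → M) : (I →₀ A) →+ RTensor R M A :=
  Finsupp.liftAddHom fun i => mk R M A (e i)

lemma combination_coordSMul (e : I → M) (s : I →₀ Rᵐᵒᵖ) (a : A) :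
    combination e (coordSMul s a) = mk R M A (Finsupp.linearCombination Rᵐᵒᵖ e s) a := by
  induction s using Finsupp.induction_linear with
  | zero => simp
  | add s t hs ht => simp [hs, ht]
  | single i r => simp [coordSMul, combination, mk_smul]

variable (R A) in
/-- The tuples `∑ₛ s aₛ`, the sum being over linear relations `s` between the `eᵢ`. -/
def relationSum (e : I → M) :
    (LinearMap.ker (Finsupp.linearCombination Rᵐᵒᵖ e) →₀ A) →+ (I →₀ A) :=
  Finsupp.liftAddHom fun s => coordSMul (R := R) (s : I →₀ Rᵐᵒᵖ)

lemma relationSum_apply (e : I → M)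
    (z : LinearMap.ker (Finsupp.linearCombination Rᵐᵒᵖ e) →₀ A) (i : I) :
    relationSum R A e z i = ∑ s ∈ z.support, (s.1 i).unop • z s := by
  simp [relationSum, Finsupp.sum, coordSMul_apply, Finsupp.finsetSum_apply]

lemma combination_relationSum (e : I → M)
    (z : LinearMap.ker (Finsupp.linearCombination Rᵐᵒᵖ e) →₀ A) :
    combination e (relationSum R A e z) = (0 : RTensor R M A) := by
  induction z using Finsupp.induction_linear with
  | zero => simp
  | add z z' hz hz' => simp [hz, hz']
  | single s a => simp [relationSum, combination_coordSMul, LinearMap.mem_ker.1 s.2]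

lemma coordSMul_mem_range_relationSum {e : I → M} {s : I →₀ Rᵐᵒᵖ}
    (hs : Finsupp.linearCombination Rᵐᵒᵖ e s = 0) (a : A) :
    coordSMul s a ∈ (relationSum R A e).range :=
  ⟨Finsupp.single ⟨s, hs⟩ a, by simp [relationSum]⟩

lemma mk_coordSMul_eq {e : I → M} {s t : I →₀ Rᵐᵒᵖ}
    (h : Finsupp.linearCombination Rᵐᵒᵖ e s = Finsupp.linearCombination Rᵐᵒᵖ e t) (a : A) :
    (coordSMul s a : (I →₀ A) ⧸ (relationSum R A e).range) = (coordSMul t a : I →₀ A) := by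
  refine QuotientAddGroup.eq_iff_sub_mem.2 ?_
  rw [← AddMonoidHom.sub_apply, ← map_sub]
  exact coordSMul_mem_range_relationSum (by rw [map_sub, h, sub_self]) a

variable (A) in
/-- A left inverse of `∑ eᵢ ⊗ xᵢ ↤ x` modulo `relationSum`: expand the first factor
in the generators `e`. -/
def expand {e : I → M} (he : Function.Surjective (Finsupp.linearCombination Rᵐᵒᵖ e)) :
    RTensor R M A →+ (I →₀ A) ⧸ (relationSum R A e).range :=
  lift
    (AddMonoidHom.mk' (fun m => (QuotientAddGroup.mk' (relationSum R A e).range).comp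
        (coordSMul (Function.surjInv he m))) fun m m' => by
      ext a
      refine (mk_coordSMul_eq (t := Function.surjInv he m + Function.surjInv he m') ?_ a).trans
        (by simp)
      simp [Function.surjInv_eq he])
    fun m r a => by
      refine (mk_coordSMul_eq (t := MulOpposite.op r • Function.surjInv he m) ?_ a).trans ?_
      · simp [Function.surjInv_eq he]
      · refine congrArg QuotientAddGroup.mk (Finsupp.ext fun i => ?_)
        simp [coordSMul_apply, mul_smul]

lemma expand_combination {e : I → M}
    (he : Function.Surjective (Finsupp.linearCombination Rᵐᵒᵖ e)) (x : I →₀ A) :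
    expand A he (combination e x) = x := by
  induction x using Finsupp.induction_linear with
  | zero => simp
  | add x y hx hy => simp [hx, hy]
  | single i a =>
    have h : combination e (Finsupp.single i a) = mk R M A (e i) a := by simp [combination]
    rw [h]
    refine (mk_coordSMul_eq (t := Finsupp.single i 1) ?_ a).trans (by simp [coordSMul])
    simp [Function.surjInv_eq he]

lemma relationSum_combination_exact {e : I → M}
    (he : Function.Surjective (Finsupp.linearCombination Rᵐᵒᵖ e)) :
    Function.Exact (relationSum R A e) (combination (R := R) e) := fun x => by
  refine ⟨fun hx => ?_, by rintro ⟨z, rfl⟩; exact combination_relationSum e z⟩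
  refine (QuotientAddGroup.eq_zero_iff (N := (relationSum R A e).range) x).1 ?_
  rw [← expand_combination (R := R) he, hx, map_zero]

lemma combination_mapRange (e : I → M) (f : A →ₗ[R] B) (x : I →₀ A) :
    map M f (combination e x) = combination e (x.mapRange f f.map_zero) := by
  induction x using Finsupp.induction_linear with
  | zero => simp
  | add x y hx hy => simp [hx, hy, Finsupp.mapRange_add]
  | single i a => simp [combination, map_mk]

lemma combination_surjective {e : I → M}
    (he : Function.Surjective (Finsupp.linearCombination Rᵐᵒᵖ e)) :
    Function.Surjective (combination (R := R) (A := A) e) := fun t => by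
  obtain ⟨t, rfl⟩ := QuotientAddGroup.mk_surjective t
  induction t using TensorProduct.induction_on with
  | zero => exact ⟨0, map_zero _⟩
  | tmul m a =>
    obtain ⟨s, rfl⟩ := he m
    exact ⟨coordSMul s a, combination_coordSMul e s a⟩
  | add t t' ht ht' =>
    obtain ⟨x, hx⟩ := ht
    obtain ⟨y, hy⟩ := ht'
    exact ⟨x + y, by rw [map_add, hx, hy]; rfl⟩

end RTensor

section TensorCriterion

variable {R : Type w} [Ring R]

open RTensor

lemma ReflectsSystems.map_injective {A B : Type*} [AddCommGroup A] [Module R A] [AddCommGroup B]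
    [Module R B] {f : A →ₗ[R] B} (hf : ReflectsSystems f) (M : Type*) [AddCommGroup M]
    [Module Rᵐᵒᵖ M] : Function.Injective (RTensor.map M f) := by
  classical
  have hid : Function.Surjective (Finsupp.linearCombination Rᵐᵒᵖ (id : M → M)) := fun m =>
    ⟨Finsupp.single m 1, by simp⟩
  refine (injective_iff_map_eq_zero _).2 fun t ht => ?_
  obtain ⟨x, rfl⟩ := combination_surjective (R := R) hid t
  rw [combination_mapRange] at ht
  obtain ⟨z, hz⟩ := (relationSum_combination_exact hid _).1 ht
  have hfx (m : M) : f (x m) = ∑ s ∈ z.support, (s.1 m).unop • z s :=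
    (DFunLike.congr_fun hz m).symm.trans (relationSum_apply _ z m)
  -- The system has to hold at all indices, so the supports of the finitely many relations
  -- are adjoined to that of `x`.
  obtain ⟨y, hy⟩ := hf.finset (x.support ∪ z.support.biUnion fun s => s.1.support) z.support
    (fun m s => (s.1 m).unop) x z fun m _ => hfx m
  have hx : x = relationSum R A id (∑ s ∈ z.support, Finsupp.single s (y s)) := by
    ext m
    have hsum : relationSum R A id (∑ s ∈ z.support, Finsupp.single s (y s)) m =
        ∑ s ∈ z.support, (s.1 m).unop • y s := by
      simp [relationSum, coordSMul_apply, Finsupp.finsetSum_apply]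
    rw [hsum]
    by_cases hm : m ∈ x.support ∪ z.support.biUnion fun s => s.1.support
    · exact hy m hm
    · simp only [Finset.mem_union, Finset.mem_biUnion, Finsupp.mem_support_iff, not_or, not_not,
        not_exists, not_and] at hm
      rw [hm.1, Finset.sum_eq_zero]
      intro s hs
      simp [hm.2 s (Finsupp.mem_support_iff.1 hs)]
  rw [hx, combination_relationSum]

section

variable {m n : ℕ} (a : Fin m → Fin n → R)

/-- The `j`-th column of `a`, as an element of a free right module. -/
def column (j : Fin n) : Fin m →₀ Rᵐᵒᵖ :=
  Finsupp.equivFunOnFinite.symm fun i => MulOpposite.op (a i j)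

/-- The cokernel of the matrix `a` acting on column vectors: the right module with generators
`e₁, …, eₘ` and relations `∑ᵢ eᵢ aᵢⱼ = 0`, lifted to the universe in which purity is tested. -/
abbrev RightCokernel : Type (max w v) :=
  ULift.{v} ((Fin m →₀ Rᵐᵒᵖ) ⧸ Submodule.span Rᵐᵒᵖ (Set.range (column a)))

/-- The projection from the free right module. -/
def RightCokernel.π : (Fin m →₀ Rᵐᵒᵖ) →ₗ[Rᵐᵒᵖ] RightCokernel.{w, v} a :=
  ULift.moduleEquiv.symm.toLinearMap ∘ₗ Submodule.mkQ _

lemma RightCokernel.π_surjective : Function.Surjective (RightCokernel.π.{w, v} a) :=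
  ULift.moduleEquiv.symm.surjective.comp (Submodule.mkQ_surjective _)

lemma RightCokernel.π_eq_zero_iff {s : Fin m →₀ Rᵐᵒᵖ} :
    RightCokernel.π.{w, v} a s = 0 ↔ ∃ t : Fin n → R, ∀ i, (s i).unop = ∑ j, a i j * t j := by
  have h : RightCokernel.π.{w, v} a s = 0 ↔ ∃ t : Fin n → Rᵐᵒᵖ, ∑ j, t j • column a j = s := by
    rw [← Submodule.mem_span_range_iff_exists_fun, ← Submodule.Quotient.mk_eq_zero]
    exact ULift.moduleEquiv.symm.map_eq_zero_iff
  rw [h, (Equiv.arrowCongr (Equiv.refl (Fin n)) MulOpposite.opEquiv.symm).exists_congr_left]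
  refine exists_congr fun t => DFunLike.ext_iff.trans (forall_congr' fun i => ?_)
  rw [← MulOpposite.unop_inj, eq_comm]
  simp [column, Finsupp.finsetSum_apply]

/-- The `i`-th generator `eᵢ` of the cokernel. -/
def RightCokernel.gen (i : Fin m) : RightCokernel.{w, v} a :=
  RightCokernel.π a (Finsupp.single i 1)

lemma RightCokernel.linearCombination_gen :
    Finsupp.linearCombination Rᵐᵒᵖ (RightCokernel.gen a) = RightCokernel.π.{w, v} a :=
  Finsupp.lhom_ext' fun i => LinearMap.ext_ring (by simp [RightCokernel.gen])

lemma RightCokernel.combination_gen_eq_zero {B : Type*} [AddCommGroup B] [Module R B]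
    (b : Fin n → B) :
    combination (R := R) (RightCokernel.gen.{w, v} a)
      (Finsupp.equivFunOnFinite.symm fun i => ∑ j, a i j • b j) = 0 := by
  have h : Finsupp.equivFunOnFinite.symm (fun i => ∑ j, a i j • b j) =
      ∑ j, coordSMul (column a j) (b j) := by
    ext i
    simp [coordSMul_apply, column, Finsupp.finsetSum_apply]
  rw [h, map_sum]
  refine Finset.sum_eq_zero fun j _ => ?_
  have hj : RightCokernel.π.{w, v} a (column a j) = 0 :=
    (RightCokernel.π_eq_zero_iff a).2 ⟨Pi.single j 1, fun i => by simp [column, Pi.single_apply]⟩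
  rw [combination_coordSMul, RightCokernel.linearCombination_gen, hj, map_zero,
    AddMonoidHom.zero_apply]

end

lemma reflectsSystems_of_map_injective {A B : Type*} [AddCommGroup A] [Module R A]
    [AddCommGroup B] [Module R B] {f : A →ₗ[R] B}
    (hf : ∀ (M : Type (max w v)) [AddCommGroup M] [Module Rᵐᵒᵖ M],
      Function.Injective (RTensor.map M f)) : ReflectsSystems f := by
  intro m n a x b hx
  have hgen : Function.Surjective (Finsupp.linearCombination Rᵐᵒᵖ (RightCokernel.gen.{w, v} a)) :=
    RightCokernel.linearCombination_gen.{w, v} a ▸ RightCokernel.π_surjective a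
  have hzero : combination (R := R) (RightCokernel.gen.{w, v} a)
      (Finsupp.equivFunOnFinite.symm x) = 0 := by
    refine hf _ (Eq.trans ?_ (map_zero _).symm)
    rw [combination_mapRange, ← RightCokernel.combination_gen_eq_zero a b]
    exact congrArg _ (Finsupp.ext hx)
  obtain ⟨z, hz⟩ := (relationSum_combination_exact hgen _).1 hzero
  have hrel (s : LinearMap.ker (Finsupp.linearCombination Rᵐᵒᵖ (RightCokernel.gen.{w, v} a))) :
      ∃ t : Fin n → R, ∀ i, (s.1 i).unop = ∑ j, a i j * t j := by
    rw [← RightCokernel.π_eq_zero_iff.{w, v}, ← RightCokernel.linearCombination_gen]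
    exact s.2
  choose t ht using hrel
  refine ⟨fun j => ∑ s ∈ z.support, t s j • z s, fun i => ?_⟩
  have hxi : x i = ∑ s ∈ z.support, (s.1 i).unop • z s :=
    (DFunLike.congr_fun hz i).symm.trans (relationSum_apply _ z i)
  simp only [hxi, ht, Finset.sum_smul, Finset.smul_sum, mul_smul]
  exact Finset.sum_comm

end TensorCriterion

/-! ### Purity of submodules and of linear maps -/

section Purity

variable {R : Type w} [Ring R] {A B C : Type*} [AddCommGroup A] [Module R A] [AddCommGroup B]
  [Module R B] [AddCommGroup C] [Module R C] {f : A →ₗ[R] B} {g : B →ₗ[R] C}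

/-- A submodule is pure if its inclusion is a pure monomorphism. -/
def IsPureSubmodule (N : Submodule R B) : Prop :=
  ReflectsSystems N.subtype

lemma reflectsSystems_iff :
    ReflectsSystems f ↔ Function.Injective f ∧ IsPureSubmodule (LinearMap.range f) := by
  refine ⟨fun h => ⟨h.injective, fun m n a x b hx => ?_⟩, fun ⟨hf, h⟩ m n a x b hx => ?_⟩
  · choose v hv using fun i => (x i).2
    obtain ⟨y, hy⟩ := h m n a v b fun i => (hv i).trans (hx i)
    exact ⟨fun j => f.rangeRestrict (y j), fun i => Subtype.ext (by simp [← hv, hy])⟩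
  · obtain ⟨y, hy⟩ := h m n a (fun i => f.rangeRestrict (x i)) b hx
    choose z hz using fun j => (y j).2
    exact ⟨z, fun i => hf (by simpa [hz] using congrArg Subtype.val (hy i))⟩

lemma liftsSystems_iff :
    LiftsSystems g ↔ Function.Surjective g ∧ IsPureSubmodule (LinearMap.ker g) := by
  have h : Function.Exact (LinearMap.ker g).subtype g := LinearMap.exact_subtype_ker_map g
  exact ⟨fun hg => ⟨hg.surjective, hg.reflectsSystems h (Submodule.subtype_injective _)⟩,
    fun ⟨hg, hker⟩ => hker.liftsSystems h hg⟩

/-- Exactness of `Hom(F, A) → Hom(F, B) → Hom(F, C)` for all finitely presented modules `F`,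
where `F` is given by a matrix of relations. -/
def HomExact (f : A →ₗ[R] B) (g : B →ₗ[R] C) : Prop :=
  ∀ (m n : ℕ) (a : Fin m → Fin n → R) (x : Fin n → B), (∀ i, ∑ j, a i j • x j = 0) →
    (∀ j, g (x j) = 0) → ∃ y : Fin n → A, (∀ i, ∑ j, a i j • y j = 0) ∧ ∀ j, f (y j) = x j

/-- Exactness of `M ⊗ A → M ⊗ B → M ⊗ C` for all finitely presented right modules `M`, where `M`
is given by a matrix of relations. -/
def TensorExact (f : A →ₗ[R] B) (g : B →ₗ[R] C) : Prop :=
  ∀ (m n : ℕ) (a : Fin m → Fin n → R) (x : Fin m → B) (b : Fin n → C),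
    (∀ i, g (x i) = ∑ j, a i j • b j) →
      ∃ (y : Fin n → B) (z : Fin m → A), ∀ i, x i = ∑ j, a i j • y j + f (z i)

lemma HomExact.exists_eq (h : HomExact f g) (x : B) (hx : g x = 0) : ∃ y, f y = x := by
  obtain ⟨y, -, hy⟩ := h 0 1 (fun _ _ => 0) (fun _ => x) (fun i => i.elim0) fun _ => hx
  exact ⟨y 0, hy 0⟩

lemma TensorExact.exists_eq (h : TensorExact f g) (x : B) (hx : g x = 0) : ∃ y, f y = x := by
  obtain ⟨y, z, hz⟩ := h 1 0 (fun _ _ => 0) (fun _ => x) (fun i => i.elim0) fun _ => by simpa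
  exact ⟨z 0, by simpa using (hz 0).symm⟩

lemma homExact_iff (h : g ∘ₗ f = 0) :
    HomExact f g ↔ Function.Exact f g ∧ IsPureSubmodule (LinearMap.ker f) := by
  have hgf (x : A) : g (f x) = 0 := LinearMap.congr_fun h x
  have hker : IsPureSubmodule (LinearMap.ker f) ↔ LiftsSystems f.rangeRestrict := by
    rw [liftsSystems_iff, f.ker_rangeRestrict]
    simp [f.surjective_rangeRestrict]
  rw [hker]
  refine ⟨fun H => ⟨fun x => ⟨H.exists_eq x, ?_⟩, fun m n a c hc => ?_⟩,
    fun ⟨hex, H⟩ m n a x hx hgx => ?_⟩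
  · rintro ⟨y, rfl⟩
    exact hgf y
  · obtain ⟨y, hy, hyc⟩ := H m n a (fun j => c j)
      (fun i => by simpa using congrArg Subtype.val (hc i)) fun j => by
        obtain ⟨x, hx⟩ := (c j).2
        rw [← hx, hgf]
    exact ⟨y, hy, fun j => Subtype.ext (hyc j)⟩
  · obtain ⟨y, hy, hyx⟩ := H m n a (fun j => ⟨x j, (hex _).1 (hgx j)⟩) fun i =>
      Subtype.ext (by simpa using hx i)
    exact ⟨y, hy, fun j => congrArg Subtype.val (hyx j)⟩

lemma tensorExact_iff (h : g ∘ₗ f = 0) :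
    TensorExact f g ↔ Function.Exact f g ∧ IsPureSubmodule (LinearMap.range g) := by
  have hgf (x : A) : g (f x) = 0 := LinearMap.congr_fun h x
  refine ⟨fun H => ⟨fun x => ⟨H.exists_eq x, ?_⟩, fun m n a c b hc => ?_⟩,
    fun ⟨hex, H⟩ m n a x b hx => ?_⟩
  · rintro ⟨y, rfl⟩
    exact hgf y
  · choose x hx using fun i => (c i).2
    obtain ⟨y, z, hy⟩ := H m n a x b fun i => (hx i).trans (hc i)
    exact ⟨fun j => g.rangeRestrict (y j), fun i => Subtype.ext (by simp [← hx, hy, hgf])⟩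
  · obtain ⟨c, hc⟩ := H m n a (fun i => g.rangeRestrict (x i)) b hx
    choose y hy using fun j => (c j).2
    have hgx (i : Fin m) : g (x i - ∑ j, a i j • y j) = 0 := by
      simpa [hy, sub_eq_zero] using congrArg Subtype.val (hc i)
    choose z hz using fun i => (hex _).1 (hgx i)
    exact ⟨y, z, fun i => by simp [hz]⟩

end Purity

section PureMorphisms

variable {R : Type w} [Ring R] {A B C : ModuleCat.{v} R}

lemma shortExact_iff (S : ShortComplex (ModuleCat.{v} R)) :
    S.ShortExact ↔ Function.Injective S.f.hom ∧ Function.Exact S.f.hom S.g.hom ∧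
      Function.Surjective S.g.hom := by
  rw [← ModuleCat.mono_iff_injective, ← ModuleCat.epi_iff_surjective,
    ← ShortComplex.ShortExact.moduleCat_exact_iff_function_exact]
  exact ⟨fun h => ⟨h.mono_f, h.exact, h.epi_g⟩,
    fun ⟨hf, h, hg⟩ => { exact := h, mono_f := hf, epi_g := hg }⟩

lemma isPureShortExact_iff_reflectsSystems {S : ShortComplex (ModuleCat.{v} R)} :
    IsPureShortExact S ↔ S.ShortExact ∧ ReflectsSystems S.f.hom := by
  refine and_congr_right fun hS => ⟨fun h => reflectsSystems_of_map_injective fun M _ _ => (h M).1,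
    fun h M _ _ => ?_⟩
  obtain ⟨-, hexact, hg⟩ := (shortExact_iff S).1 hS
  exact ⟨h.map_injective M, RTensor.map_exact hexact hg, RTensor.map_surjective hg⟩

lemma isPureShortExact_iff_liftsSystems {S : ShortComplex (ModuleCat.{v} R)} :
    IsPureShortExact S ↔ S.ShortExact ∧ LiftsSystems S.g.hom := by
  rw [isPureShortExact_iff_reflectsSystems]
  refine and_congr_right fun hS => ?_
  obtain ⟨hf, hexact, hg⟩ := (shortExact_iff S).1 hS
  exact ⟨fun h => h.liftsSystems hexact hg, fun h => h.reflectsSystems hexact hf⟩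

lemma isPureEpi_iff {g : B ⟶ C} : IsPureEpi g ↔ LiftsSystems g.hom := by
  refine ⟨fun ⟨_, _, _, hS⟩ => (isPureShortExact_iff_liftsSystems.1 hS).2, fun h => ?_⟩
  refine ⟨ModuleCat.of R (LinearMap.ker g.hom), ModuleCat.ofHom (LinearMap.ker g.hom).subtype,
    ModuleCat.hom_ext g.hom.comp_ker_subtype, isPureShortExact_iff_liftsSystems.2 ⟨?_, h⟩⟩
  exact (shortExact_iff _).2 ⟨Subtype.val_injective, LinearMap.exact_subtype_ker_map _,
    h.surjective⟩

lemma isPureMono_iff {f : A ⟶ B} : IsPureMono f ↔ ReflectsSystems f.hom := by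
  refine ⟨fun ⟨_, _, _, hS⟩ => (isPureShortExact_iff_reflectsSystems.1 hS).2, fun h => ?_⟩
  refine ⟨ModuleCat.of R (B ⧸ LinearMap.range f.hom), ModuleCat.ofHom (LinearMap.range f.hom).mkQ,
    ModuleCat.hom_ext f.hom.range_mkQ_comp, isPureShortExact_iff_reflectsSystems.2 ⟨?_, h⟩⟩
  exact (shortExact_iff _).2 ⟨h.injective, LinearMap.exact_map_mkQ_range _,
    Submodule.mkQ_surjective _⟩

lemma hasPureDecomposition_iff {d : A ⟶ B} :
    HasPureDecomposition d ↔
      IsPureSubmodule (LinearMap.ker d.hom) ∧ IsPureSubmodule (LinearMap.range d.hom) := by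
  constructor
  · rintro ⟨D, p, j, hp, hj, rfl⟩
    obtain ⟨hpsurj, hpker⟩ := liftsSystems_iff.1 (isPureEpi_iff.1 hp)
    obtain ⟨hjinj, hjrange⟩ := reflectsSystems_iff.1 (isPureMono_iff.1 hj)
    rw [ModuleCat.hom_comp,
      LinearMap.range_comp_of_range_eq_top _ (LinearMap.range_eq_top.2 hpsurj),
      LinearMap.ker_comp_of_ker_eq_bot _ (LinearMap.ker_eq_bot.2 hjinj)]
    exact ⟨hpker, hjrange⟩
  · rintro ⟨hker, hrange⟩
    refine ⟨ModuleCat.of R (LinearMap.range d.hom), ModuleCat.ofHom d.hom.rangeRestrict,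
      ModuleCat.ofHom (LinearMap.range d.hom).subtype, isPureEpi_iff.2 (liftsSystems_iff.2
        ⟨d.hom.surjective_rangeRestrict, ?_⟩), isPureMono_iff.2 hrange, rfl⟩
    rwa [ModuleCat.hom_ofHom, d.hom.ker_rangeRestrict]

lemma range_kernel_ι (d : A ⟶ B) :
    LinearMap.range (kernel.ι d).hom = LinearMap.ker d.hom := by
  rw [← ModuleCat.kernelIsoKer_hom_ker_subtype, ModuleCat.hom_comp,
    LinearMap.range_comp_of_range_eq_top _ (LinearMap.range_eq_top.2
      ((ModuleCat.epi_iff_surjective _).1 inferInstance))]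
  exact Submodule.range_subtype _

lemma ker_cokernel_π (d : A ⟶ B) :
    LinearMap.ker (cokernel.π d).hom = LinearMap.range d.hom := by
  rw [← ModuleCat.range_mkQ_cokernelIsoRangeQuotient_inv, ModuleCat.hom_comp,
    LinearMap.ker_comp_of_ker_eq_bot _ (LinearMap.ker_eq_bot.2
      ((ModuleCat.mono_iff_injective _).1 inferInstance))]
  exact Submodule.ker_mkQ _

end PureMorphisms

/-! ### Pure exactness of complexes -/

section Complexes

variable {R : Type w} [Ring R] {X : CochainComplex (ModuleCat.{v} R) ℤ} {i j k : ℤ}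

/-- Exactness of `Hom(F, X)` in degree `k` for all finitely presented modules `F`. -/
def HomExactAt (X : CochainComplex (ModuleCat.{v} R) ℤ) (k : ℤ) : Prop :=
  HomExact (X.d (k - 1) k).hom (X.d k (k + 1)).hom

/-- Exactness of `M ⊗ X` in degree `k` for all finitely presented right modules `M`. -/
def TensorExactAt (X : CochainComplex (ModuleCat.{v} R) ℤ) (k : ℤ) : Prop :=
  TensorExact (X.d (k - 1) k).hom (X.d k (k + 1)).hom

lemma d_comp_d_hom (X : CochainComplex (ModuleCat.{v} R) ℤ) (i j k : ℤ) :
    (X.d j k).hom ∘ₗ (X.d i j).hom = 0 := by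
  rw [← ModuleCat.hom_comp, X.d_comp_d, ModuleCat.hom_zero]

lemma d_d_apply (X : CochainComplex (ModuleCat.{v} R) ℤ) (i j k : ℤ) (x : X.X i) :
    (X.d j k).hom ((X.d i j).hom x) = 0 :=
  LinearMap.congr_fun (d_comp_d_hom X i j k) x

lemma HomExactAt.homExact (h : HomExactAt X j) (hi : i + 1 = j) (hk : j + 1 = k) :
    HomExact (X.d i j).hom (X.d j k).hom := by
  obtain rfl : i = j - 1 := by lia
  exact hk ▸ h

lemma TensorExactAt.tensorExact (h : TensorExactAt X j) (hi : i + 1 = j)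
    (hk : j + 1 = k) : TensorExact (X.d i j).hom (X.d j k).hom := by
  obtain rfl : i = j - 1 := by lia
  exact hk ▸ h

lemma homExactAt_iff (hi : i + 1 = j) (hk : j + 1 = k) : HomExactAt X j ↔
    Function.Exact (X.d i j).hom (X.d j k).hom ∧ IsPureSubmodule (LinearMap.ker (X.d i j).hom) := by
  obtain rfl : i = j - 1 := by lia
  subst hk
  exact homExact_iff (d_comp_d_hom X _ _ _)

lemma tensorExactAt_iff (hi : i + 1 = j) (hk : j + 1 = k) : TensorExactAt X j ↔
    Function.Exact (X.d i j).hom (X.d j k).hom ∧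
      IsPureSubmodule (LinearMap.range (X.d j k).hom) := by
  obtain rfl : i = j - 1 := by lia
  subst hk
  exact tensorExact_iff (d_comp_d_hom X _ _ _)

lemma isPureExactAt_iff (hi : i + 1 = j) (hk : j + 1 = k) : IsPureExactAt X j ↔
    Function.Exact (X.d i j).hom (X.d j k).hom ∧
      IsPureSubmodule (LinearMap.ker (X.d i j).hom) ∧
      IsPureSubmodule (LinearMap.ker (X.d j k).hom) ∧
      IsPureSubmodule (LinearMap.range (X.d j k).hom) := by
  obtain rfl : i = j - 1 := by lia
  subst hk
  have hι := (ModuleCat.mono_iff_injective (kernel.ι (X.d j (j + 1)))).1 inferInstance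
  have hπ := (ModuleCat.epi_iff_surjective (cokernel.π (X.d (j - 1) j))).1 inferInstance
  have hexact : Function.Exact (X.d (j - 1) j).hom (X.d j (j + 1)).hom ↔
      Function.Exact (kernel.ι (X.d j (j + 1))).hom (cokernel.π (X.d (j - 1) j)).hom := by
    rw [LinearMap.exact_iff, LinearMap.exact_iff, range_kernel_ι, ker_cokernel_π, eq_comm]
  have hpure : IsPureSubmodule (LinearMap.ker (X.d j (j + 1)).hom) ↔
      ReflectsSystems (kernel.ι (X.d j (j + 1))).hom := by
    rw [reflectsSystems_iff, range_kernel_ι, and_iff_right hι]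
  have hcomp (h : Function.Exact (X.d (j - 1) j).hom (X.d j (j + 1)).hom) :
      kernel.ι (X.d j (j + 1)) ≫ cokernel.π (X.d (j - 1) j) = 0 :=
    ModuleCat.hom_ext (LinearMap.ext (hexact.1 h).apply_apply_eq_zero)
  simp only [IsPureExactAt, hasPureDecomposition_iff, isPureShortExact_iff_reflectsSystems,
    shortExact_iff, ← hexact, ← hpure]
  constructor
  · rintro ⟨⟨h₁, -⟩, ⟨h₂, h₃⟩, -, ⟨-, h, -⟩, -⟩
    exact ⟨h, h₁, h₂, h₃⟩
  · rintro ⟨h, h₁, h₂, h₃⟩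
    exact ⟨⟨h₁, (LinearMap.exact_iff.1 h) ▸ h₂⟩, ⟨h₂, h₃⟩, hcomp h, ⟨hι, h, hπ⟩, h₂⟩

lemma IsPureExactAt.homExactAt (h : IsPureExactAt X k) : HomExactAt X k :=
  let h := (isPureExactAt_iff (sub_add_cancel k 1) rfl).1 h
  (homExactAt_iff (sub_add_cancel k 1) rfl).2 ⟨h.1, h.2.1⟩

lemma IsPureExactAt.tensorExactAt (h : IsPureExactAt X k) : TensorExactAt X k :=
  let h := (isPureExactAt_iff (sub_add_cancel k 1) rfl).1 h
  (tensorExactAt_iff (sub_add_cancel k 1) rfl).2 ⟨h.1, h.2.2.2⟩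

lemma isPureExactAt_of_homExactAt (h : HomExactAt X k) (h₁ : HomExactAt X (k + 1))
    (h₂ : HomExactAt X (k + 1 + 1)) : IsPureExactAt X k := by
  obtain ⟨h, hker⟩ := (homExactAt_iff (sub_add_cancel k 1) rfl).1 h
  obtain ⟨h₁, hker₁⟩ := (homExactAt_iff rfl rfl).1 h₁
  obtain ⟨-, hker₂⟩ := (homExactAt_iff rfl rfl).1 h₂
  rw [LinearMap.exact_iff.1 h₁] at hker₂
  exact (isPureExactAt_iff (sub_add_cancel k 1) rfl).2 ⟨h, hker, hker₁, hker₂⟩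

lemma isPureExactAt_of_tensorExactAt (hi : i + 1 = j) (hk : j + 1 = k) (h : TensorExactAt X k)
    (h₁ : TensorExactAt X j) (h₂ : TensorExactAt X i) : IsPureExactAt X k := by
  obtain ⟨h, hrange⟩ := (tensorExactAt_iff hk rfl).1 h
  obtain ⟨h₁, hrange₁⟩ := (tensorExactAt_iff hi hk).1 h₁
  obtain ⟨-, hrange₂⟩ := (tensorExactAt_iff (sub_add_cancel i 1) hi).1 h₂
  rw [← LinearMap.exact_iff.1 h] at hrange₁
  rw [← LinearMap.exact_iff.1 h₁] at hrange₂
  exact (isPureExactAt_iff hk rfl).2 ⟨h, hrange₂, hrange₁, hrange⟩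

lemma isPureExact_iff_homExactAt : IsPureExact X ↔ ∀ k, HomExactAt X k :=
  ⟨fun h k => (h k).homExactAt, fun h _ => isPureExactAt_of_homExactAt (h _) (h _) (h _)⟩

lemma forall_isPureExactAt_iff_tensorExactAt (N : ℤ) :
    (∀ k < N, IsPureExactAt X k) ↔ ∀ k < N, TensorExactAt X k :=
  ⟨fun h _ hk => (h _ hk).tensorExactAt, fun h k hk => isPureExactAt_of_tensorExactAt
    (i := k - 2) (j := k - 1) (by lia) (by lia) (h k hk) (h _ (by lia)) (h _ (by lia))⟩

lemma isPureExact_iff_tensorExactAt : IsPureExact X ↔ ∀ k, TensorExactAt X k :=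
  ⟨fun h k => (h k).tensorExactAt, fun h k =>
    (forall_isPureExactAt_iff_tensorExactAt (k + 1)).2 (fun j _ => h j) k (by lia)⟩

lemma le_infP_iff (N : ℤ) : ((N : ℝ) : EReal) ≤ infP X ↔ ∀ k < N, TensorExactAt X k := by
  rw [← forall_isPureExactAt_iff_tensorExactAt, infP, le_sInf_iff]
  constructor
  · intro h k hk
    by_contra hX
    exact hk.not_ge (by simpa using h _ ⟨k, hX, rfl⟩)
  · rintro h _ ⟨k, hk, rfl⟩
    rw [EReal.coe_le_coe_iff, Int.cast_le]
    exact not_lt.1 fun hN => hk (h k hN)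

lemma isPureExactAt_of_supP_lt (h : supP X < ((k : ℝ) : EReal)) : IsPureExactAt X k := by
  by_contra hX
  exact h.not_ge (le_sSup ⟨k, hX, rfl⟩)

lemma supP_le {N : ℤ} (h : ∀ k, N < k → IsPureExactAt X k) : supP X ≤ ((N : ℝ) : EReal) := by
  refine sSup_le ?_
  rintro _ ⟨k, hk, rfl⟩
  rw [EReal.coe_le_coe_iff, Int.cast_le]
  exact not_lt.1 fun hN => hk (h k hN)

end Complexes

/-! ### Transfer of exactness along pure quasi-isomorphisms -/

section MappingCone

open CochainComplex CochainComplex.HomComplex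

variable {R : Type w} [Ring R] {P X : CochainComplex (ModuleCat.{v} R) ℤ} {f : P ⟶ X}

lemma hom_comm_apply (f : P ⟶ X) (i j : ℤ) (x : P.X i) :
    (X.d i j).hom ((f.f i).hom x) = (f.f j).hom ((P.d i j).hom x) := by
  simp only [← LinearMap.comp_apply, ← ModuleCat.hom_comp, HomologicalComplex.Hom.comm]

/-- The elements of the mapping cone in degree `j` as pairs of an element of `P` and one
of `X`. -/
def coneEquiv (f : P ⟶ X) {j k : ℤ} (hk : j + 1 = k) :
    (P.X k × X.X j) ≃ₗ[R] (mappingCone f).X j :=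
  LinearEquiv.ofLinearMap
    (((mappingCone.inl f).v k j (by lia)).hom.coprod ((mappingCone.inr f).f j).hom)
    (((mappingCone.fst f).1.v j k hk).hom.prod ((mappingCone.snd f).v j j (add_zero j)).hom)
    (congrArg ModuleCat.Hom.hom (mappingCone.id_X f j k hk))
    (by
      simp only [LinearMap.prod_comp, LinearMap.comp_coprod, ← ModuleCat.hom_comp,
        mappingCone.inl_v_fst_v, mappingCone.inl_v_snd_v, mappingCone.inr_f_fst_v,
        mappingCone.inr_f_snd_v]
      ext x <;> simp)

lemma d_coneEquiv (f : P ⟶ X) {j k l : ℤ} (hk : j + 1 = k) (hl : k + 1 = l) (p : P.X k)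
    (x : X.X j) : ((mappingCone f).d j k).hom (coneEquiv f hk (p, x)) =
      coneEquiv f hl (-(P.d k l).hom p, (f.f k).hom p + (X.d j k).hom x) := by
  have hinl : ((mappingCone f).d j k).hom (((mappingCone.inl f).v k j (by lia)).hom p) =
      ((mappingCone.inr f).f k).hom ((f.f k).hom p) -
        ((mappingCone.inl f).v l k (by lia)).hom ((P.d k l).hom p) :=
    congr($(mappingCone.inl_v_d f k j l (by lia) (by lia)).hom p)
  simp only [coneEquiv, LinearEquiv.coe_ofLinearMap, LinearMap.coprod_apply, map_add, map_neg, hinl,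
    hom_comm_apply (mappingCone.inr f) j k x]
  abel

lemma isPureQuasiIso_of_exists (h : ∀ (k : ℤ) (m n : ℕ) (a : Fin m → Fin n → R)
    (p : Fin n → P.X (k + 1)) (x : Fin n → X.X k), (∀ s, ∑ t, a s t • p t = 0) →
      (∀ s, ∑ t, a s t • x t = 0) → (∀ t, (P.d (k + 1) (k + 1 + 1)).hom (p t) = 0) →
      (∀ t, (f.f (k + 1)).hom (p t) = (X.d k (k + 1)).hom (x t)) →
      ∃ q : Fin n → P.X k, (∀ s, ∑ t, a s t • q t = 0) ∧
        ∀ t, (P.d k (k + 1)).hom (q t) = p t ∧ (f.f k).hom (q t) = x t) :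
    IsPureQuasiIso f := by
  refine isPureExact_iff_homExactAt.2 fun k m n a c hc hd => ?_
  let e := coneEquiv f (rfl : k + 1 = k + 1)
  obtain ⟨c, rfl⟩ : ∃ c' : Fin n → P.X (k + 1) × X.X k, c = fun t => e (c' t) :=
    ⟨fun t => e.symm (c t), by simp⟩
  have hsum (s : Fin m) : ∑ t, a s t • c t = 0 := e.injective (by simpa using hc s)
  have hcycle (t : Fin n) : -(P.d (k + 1) (k + 1 + 1)).hom (c t).1 = 0 ∧
      (f.f (k + 1)).hom (c t).1 + (X.d k (k + 1)).hom (c t).2 = 0 := by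
    rw [← Prod.mk_eq_zero]
    apply (coneEquiv f rfl).injective
    rw [← d_coneEquiv, map_zero]
    exact hd t
  obtain ⟨q, hq, hqc⟩ := h k m n a (fun t => -(c t).1) (fun t => (c t).2)
    (fun s => by simpa [Prod.fst_sum] using congrArg Prod.fst (hsum s))
    (fun s => by simpa [Prod.snd_sum] using congrArg Prod.snd (hsum s))
    (fun t => by rw [map_neg, (hcycle t).1])
    (fun t => by rw [map_neg, neg_eq_of_add_eq_zero_right (hcycle t).2])
  refine ⟨fun t => coneEquiv f (sub_add_cancel k 1) (q t, 0), fun s => ?_, fun t => ?_⟩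
  · rw [← (coneEquiv f (sub_add_cancel k 1)).map_zero]
    simp only [← map_smul, ← map_sum]
    congr 1
    ext <;> simp [Prod.fst_sum, Prod.snd_sum, hq]
  · rw [d_coneEquiv f (sub_add_cancel k 1) rfl, (hqc t).1, (hqc t).2]
    simp [e]

lemma IsPureQuasiIso.exists_eq (hf : IsPureQuasiIso f) {i j k l : ℤ} (hi : i + 1 = j)
    (hj : j + 1 = k) (hk : k + 1 = l) {m n : ℕ} (a : Fin m → Fin n → R)
    (p : Fin m → P.X k) (x : Fin m → X.X j) (b : Fin n → P.X l) (c : Fin n → X.X k)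
    (hp : ∀ s, (P.d k l).hom (p s) = ∑ t, a s t • b t)
    (hx : ∀ s, (f.f k).hom (p s) + (X.d j k).hom (x s) = ∑ t, a s t • c t) :
    ∃ (q : Fin n → P.X k) (r : Fin m → P.X j) (y : Fin n → X.X j) (z : Fin m → X.X i),
      (∀ s, p s = ∑ t, a s t • q t - (P.d j k).hom (r s)) ∧
      ∀ s, x s = ∑ t, a s t • y t + ((f.f j).hom (r s) + (X.d i j).hom (z s)) := by
  obtain ⟨q, r, h⟩ := ((isPureExact_iff_tensorExactAt.1 hf j).tensorExact hi hj) _ _ a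
    (fun s => coneEquiv f hj (p s, x s)) (fun t => coneEquiv f hk (-b t, c t)) fun s => by
      rw [d_coneEquiv f hj hk, hp, hx]
      simp only [← map_smul, ← map_sum]
      congr 1
      ext <;> simp [Prod.fst_sum, Prod.snd_sum]
  obtain ⟨q, rfl⟩ : ∃ q' : Fin n → P.X k × X.X j, q = fun t => coneEquiv f hj (q' t) :=
    ⟨fun t => (coneEquiv f hj).symm (q t), by simp⟩
  obtain ⟨r, rfl⟩ : ∃ r' : Fin m → P.X j × X.X i, r = fun s => coneEquiv f hi (r' s) :=
    ⟨fun s => (coneEquiv f hi).symm (r s), by simp⟩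
  have hpair (s : Fin m) : (p s, x s) = ∑ t, a s t • q t +
      (-(P.d j k).hom (r s).1, (f.f j).hom (r s).1 + (X.d i j).hom (r s).2) := by
    apply (coneEquiv f hj).injective
    rw [h, ← Prod.mk.eta (p := r s), d_coneEquiv f hi hj]
    simp only [map_add, map_sum, map_smul]
  refine ⟨fun t => (q t).1, fun s => (r s).1, fun t => (q t).2, fun s => (r s).2,
    fun s => ?_, fun s => ?_⟩
  · simpa [Prod.fst_sum, sub_eq_add_neg] using congrArg Prod.fst (hpair s)
  · simpa [Prod.snd_sum] using congrArg Prod.snd (hpair s)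

lemma IsPureQuasiIso.tensorExactAt_target (hf : IsPureQuasiIso f) {k : ℤ}
    (h : TensorExactAt P k) : TensorExactAt X k := by
  intro m n a x b hx
  obtain ⟨q, r, y, z, hq, hy⟩ := hf.exists_eq (sub_add_cancel k 1) rfl rfl a 0 x 0 b
    (by simp) (by simpa using hx)
  obtain ⟨q', r', hr⟩ := h _ _ a r q fun s =>
    (sub_eq_zero.1 (hq s).symm).symm
  refine ⟨fun t => y t + (f.f k).hom (q' t), fun s => z s + (f.f (k - 1)).hom (r' s), fun s => ?_⟩
  rw [hy, hr]
  simp only [map_add, map_sum, map_smul, smul_add, Finset.sum_add_distrib, hom_comm_apply]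
  abel

lemma IsPureQuasiIso.tensorExactAt_source (hf : IsPureQuasiIso f) {k : ℤ}
    (h : TensorExactAt X k) : TensorExactAt P k := by
  intro m n a p b hp
  obtain ⟨y, z, hy⟩ := h _ _ a (fun s => (f.f k).hom (p s)) (fun t => (f.f (k + 1)).hom (b t))
    fun s => by simp [hom_comm_apply, hp]
  obtain ⟨q, r, -, -, hq, -⟩ := hf.exists_eq (i := k - 1 - 1) (sub_add_cancel _ 1)
    (sub_add_cancel k 1) rfl a p (-z) b y hp (fun s => by simp [hy])
  exact ⟨q, -r, fun s => by simpa [sub_eq_add_neg] using hq s⟩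

end MappingCone

/-! ### Pure projective modules and pure K-projective complexes -/

section PureProjective

variable {R : Type w} [Ring R] {M N : ModuleCat.{v} R}

lemma IsPureProjective.exists_lift {B C : ModuleCat.{v} R} (hM : IsPureProjective M)
    {g : B ⟶ C} (hg : LiftsSystems g.hom) (φ : M ⟶ C) : ∃ ψ : M ⟶ B, ψ ≫ g = φ := by
  obtain ⟨_, _, _, hS⟩ := isPureEpi_iff.2 hg
  exact hM _ hS φ

lemma IsPureProjective.of_isZero (hM : IsZero M) : IsPureProjective M :=
  fun _ _ _ => ⟨0, hM.eq_of_src _ _⟩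

lemma IsPureProjective.of_retract (hN : IsPureProjective N) (r : Retract M N) :
    IsPureProjective M := fun S hS g => by
  obtain ⟨ψ, hψ⟩ := hN S hS (r.r ≫ g)
  exact ⟨r.i ≫ ψ, by rw [Category.assoc, hψ, r.retract_assoc]⟩

lemma isPureProjective_sigma {I : Type v} {F : I → ModuleCat.{v} R}
    (hF : ∀ i, IsPureProjective (F i)) : IsPureProjective (∐ F) := fun S hS g => by
  choose ψ hψ using fun i => hF i S hS (Sigma.ι F i ≫ g)
  exact ⟨Sigma.desc ψ, by ext i : 1; simp [hψ]⟩

lemma IsPureProjective.exists_comp_eq (hM : IsPureProjective M) {A B C : ModuleCat.{v} R}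
    {f : A ⟶ B} {g : B ⟶ C} (h : f ≫ g = 0) (hfg : HomExact f.hom g.hom) (φ : M ⟶ B)
    (hφ : φ ≫ g = 0) : ∃ ψ : M ⟶ A, ψ ≫ f = φ := by
  let Z := LinearMap.ker g.hom
  let p : A ⟶ ModuleCat.of R Z :=
    ModuleCat.ofHom (f.hom.codRestrict Z fun x => congr($(h).hom x))
  have hp : LiftsSystems p.hom := fun m n a c hc => by
    obtain ⟨y, hy, hyc⟩ := hfg m n a (fun j => (c j).1)
      (fun i => by simpa using congrArg Subtype.val (hc i)) fun j => (c j).2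
    exact ⟨y, hy, fun j => Subtype.ext (hyc j)⟩
  obtain ⟨ψ, hψ⟩ := hM.exists_lift hp
    (ModuleCat.ofHom (φ.hom.codRestrict Z fun x => congr($(hφ).hom x)))
  exact ⟨ψ, ModuleCat.hom_ext (LinearMap.ext fun x => congrArg Subtype.val congr($(hψ).hom x))⟩

end PureProjective

section NullHomotopy

open CochainComplex CochainComplex.HomComplex

variable {R : Type w} [Ring R] {K L : CochainComplex (ModuleCat.{v} R) ℤ}

lemma exists_cochain_eq_of_eventually_constant {n : ℤ} (N : ℤ) (s : ℕ → Cochain K L n)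
    (hs : ∀ (k : ℕ) (p q : ℤ) (h : p + n = q), N - k ≤ p → (s (k + 1)).v p q h = (s k).v p q h) :
    ∃ γ : Cochain K L n, ∀ (k : ℕ) (p q : ℤ) (h : p + n = q), N - k ≤ p →
      γ.v p q h = (s k).v p q h := by
  have hstable (k l : ℕ) (p q : ℤ) (h : p + n = q) (hp : N - k ≤ p) :
      (s (k + l)).v p q h = (s k).v p q h := by
    induction l with
    | zero => rfl
    | succ l ih => exact (hs (k + l) p q h (by lia)).trans ih
  refine ⟨Cochain.mk fun p q h => (s (N - p).toNat).v p q h, fun k p q h hp => ?_⟩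
  obtain ⟨l, rfl⟩ := Nat.exists_eq_add_of_le (Int.toNat_le.2 (show N - p ≤ k by lia))
  exact (hstable _ l p q h (by lia)).symm

lemma δ_neg_one_v (α : Cochain K L (-1)) {i j k : ℤ} (hi : i + 1 = j) (hk : j + 1 = k) :
    (δ (-1) 0 α).v j j (add_zero j) =
      α.v j i (by lia) ≫ L.d i j + K.d j k ≫ α.v k j (by lia) := by
  simp [δ_v (-1) 0 (by lia) α j j (add_zero j) i k (by lia) hk]

lemma exists_extend_homotopy (f : K ⟶ L) {i : ℤ} (hK : IsPureProjective (K.X i))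
    (hL : HomExactAt L i) (α : Cochain K L (-1))
    (hα : ∀ j, i < j → (δ (-1) 0 α).v j j (add_zero j) = f.f j) :
    ∃ β : Cochain K L (-1), (∀ j, i ≤ j → (δ (-1) 0 β).v j j (add_zero j) = f.f j) ∧
      ∀ p q h, i < p → β.v p q h = α.v p q h := by
  have hcycle : (f.f i - (δ (-1) 0 α).v i i (add_zero i)) ≫ L.d i (i + 1) = 0 := by
    have h := hα (i + 1) (by lia)
    rw [δ_neg_one_v α rfl rfl] at h
    rw [δ_neg_one_v α (sub_add_cancel i 1) rfl, Preadditive.sub_comp, f.comm, ← h]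
    simp
  obtain ⟨ψ, hψ⟩ := hK.exists_comp_eq (L.d_comp_d _ _ _) hL _ hcycle
  refine ⟨α + Cochain.single ψ (-1), fun j hj => ?_, fun p q h hp => ?_⟩
  · rw [δ_add, Cochain.add_v, δ_neg_one_v (Cochain.single ψ (-1)) (sub_add_cancel j 1) rfl,
      Cochain.single_v_eq_zero ψ _ (j + 1) _ _ (by lia), comp_zero, add_zero]
    obtain rfl | hij := hj.eq_or_lt
    · rw [Cochain.single_v, hψ, add_sub_cancel]
    · rw [Cochain.single_v_eq_zero ψ _ j _ _ hij.ne', zero_comp, add_zero, hα j hij]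
  · rw [Cochain.add_v, Cochain.single_v_eq_zero ψ _ p _ _ hp.ne', add_zero]

lemma nonempty_homotopy_zero_of_isZero (N : ℤ) (hN : ∀ i, N ≤ i → IsZero (K.X i))
    (hK : ∀ i, IsPureProjective (K.X i)) (hL : ∀ i, HomExactAt L i) (f : K ⟶ L) :
    Nonempty (Homotopy f 0) := by
  let S (k : ℕ) : Type _ := {α : Cochain K L (-1) //
    ∀ j, N - k ≤ j → (δ (-1) 0 α).v j j (add_zero j) = f.f j}
  have hext (k : ℕ) (α : S k) : ∃ β : S (k + 1), ∀ p q h, N - k ≤ p →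
      β.1.v p q h = α.1.v p q h := by
    obtain ⟨β, hβ, hβα⟩ := exists_extend_homotopy f (i := N - k - 1) (hK _) (hL _) α.1
      fun j hj => α.2 j (by lia)
    exact ⟨⟨β, fun j hj => hβ j (by omega)⟩, fun p q h hp => hβα p q h (by omega)⟩
  choose next hnext using hext
  let s (k : ℕ) : S k := Nat.rec ⟨0, fun i hi => (hN i (by simpa using hi)).eq_of_src _ _⟩ next k
  obtain ⟨γ, hγ⟩ := exists_cochain_eq_of_eventually_constant N (fun k => (s k).1)
    fun k => hnext k (s k)
  refine ⟨(Cochain.equivHomotopy f 0).symm ⟨γ, ?_⟩⟩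
  rw [Cochain.ofHom_zero, add_zero]
  ext i : 1
  have hi : N - ((N - i).toNat : ℤ) ≤ i := by omega
  rw [Cochain.ofHom_v, δ_neg_one_v γ (sub_add_cancel i 1) rfl, hγ _ i _ _ hi,
    hγ _ (i + 1) _ _ (hi.trans (lt_add_one i).le), ← δ_neg_one_v _ (sub_add_cancel i 1) rfl]
  exact ((s (N - i).toNat).2 i hi).symm

end NullHomotopy

section PureExactComplexes

open CochainComplex CochainComplex.HomComplex

variable {R : Type w} [Ring R] {X Y : CochainComplex (ModuleCat.{v} R) ℤ}

lemma TensorExact.neg {A B C : Type*} [AddCommGroup A] [Module R A] [AddCommGroup B] [Module R B]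
    [AddCommGroup C] [Module R C] {f : A →ₗ[R] B} {g : B →ₗ[R] C} (h : TensorExact f g) :
    TensorExact (-f) (-g) := fun m n a x b hx => by
  obtain ⟨y, z, hyz⟩ := h m n a x (-b) fun i => by
    rw [← neg_inj, ← LinearMap.neg_apply, hx]
    simp
  exact ⟨y, -z, fun i => by simp [hyz]⟩

lemma IsPureExact.shift (h : IsPureExact X) (n : ℤ) : IsPureExact (X⟦n⟧) := by
  refine isPureExact_iff_tensorExactAt.2 fun k => ?_
  have hX : TensorExact (X.d (k - 1 + n) (k + n)).hom (X.d (k + n) (k + 1 + n)).hom :=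
    (h (k + n)).tensorExactAt.tensorExact (by lia) (by lia)
  rw [TensorExactAt, shiftFunctor_obj_d', shiftFunctor_obj_d']
  obtain hn | hn := Int.units_eq_one_or n.negOnePow
  · rw [hn, one_smul, one_smul]
    exact hX
  · rw [hn, Units.neg_smul, Units.neg_smul, one_smul, one_smul]
    exact hX.neg

/-- Homotopies contribute a boundary and a term killed by every relation, so exactness passes to
retracts up to homotopy. -/
lemma TensorExactAt.of_homotopy {k : ℤ} (h : TensorExactAt X k) (i : Y ⟶ X) (r : X ⟶ Y)
    (H : Homotopy (i ≫ r) (𝟙 Y)) : TensorExactAt Y k := by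
  intro m n a x b hx
  obtain ⟨y, z, hyz⟩ := h m n a (fun s => (i.f k).hom (x s)) (fun t => (i.f (k + 1)).hom (b t))
    fun s => by simp [hom_comm_apply, hx]
  have hH (s : Fin m) : (r.f k).hom ((i.f k).hom (x s)) =
      (H.hom (k + 1) k).hom ((Y.d k (k + 1)).hom (x s)) +
        (Y.d (k - 1) k).hom ((H.hom k (k - 1)).hom (x s)) + x s := by
    have := H.comm k
    rw [dNext_eq _ (show (ComplexShape.up ℤ).Rel k (k + 1) by simp),
      prevD_eq _ (show (ComplexShape.up ℤ).Rel (k - 1) k by simp)] at this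
    exact congr($(this).hom (x s))
  refine ⟨fun t => (r.f k).hom (y t) - (H.hom (k + 1) k).hom (b t),
    fun s => (r.f (k - 1)).hom (z s) - (H.hom k (k - 1)).hom (x s), fun s => ?_⟩
  have hs := hH s
  rw [hyz, hx] at hs
  simp only [map_add, map_sum, map_smul, ← hom_comm_apply] at hs
  simp only [smul_sub, Finset.sum_sub_distrib, map_sub]
  exact (sub_eq_iff_eq_add'.2 hs).symm.trans (by abel)

lemma IsPureExact.of_homotopyEquiv (h : IsPureExact X) (e : HomotopyEquiv X Y) : IsPureExact Y :=
  isPureExact_iff_tensorExactAt.2 fun k => (h k).tensorExactAt.of_homotopy _ _ e.homotopyInvHomId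

variable (R) in
instance : (pureExactComplexes.{w, v} R).IsClosedUnderIsomorphisms where
  of_iso {X Y} e h := by
    obtain ⟨X, rfl⟩ := HomotopyCategory.quotient_obj_surjective X
    obtain ⟨Y, rfl⟩ := HomotopyCategory.quotient_obj_surjective Y
    exact IsPureExact.of_homotopyEquiv h (HomotopyCategory.homotopyEquivOfIso e)

lemma pureExactComplexes_quotient_iff :
    pureExactComplexes R ((HomotopyCategory.quotient _ _).obj X) ↔ IsPureExact X := Iff.rfl

variable (R) in
instance : (pureExactComplexes.{w, v} R).IsStableUnderShift ℤ where
  isStableUnderShiftBy n := ⟨fun X hX => by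
    obtain ⟨X, rfl⟩ := HomotopyCategory.quotient_obj_surjective X
    exact (pureExactComplexes R).prop_of_iso
      (((HomotopyCategory.quotient _ (.up ℤ)).commShiftIso n).app X)
      (pureExactComplexes_quotient_iff.2 (IsPureExact.shift hX n))⟩

variable (R) in
/-- The pure K-projective complexes: those without nonzero maps to pure exact complexes in the
homotopy category. -/
abbrev pureKProjective :
    ObjectProperty (HomotopyCategory (ModuleCat.{v} R) (ComplexShape.up ℤ)) :=
  (pureExactComplexes.{w, v} R).leftOrthogonal

lemma pureKProjective_iff :
    pureKProjective R ((HomotopyCategory.quotient _ _).obj X) ↔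
      ∀ E : CochainComplex (ModuleCat.{v} R) ℤ, IsPureExact E → ∀ f : X ⟶ E,
        Nonempty (Homotopy f 0) := by
  refine ⟨fun h E hE f => (HomotopyCategory.quotient_map_eq_zero_iff f).1 (h _ hE),
    fun h E f hE => ?_⟩
  obtain ⟨E, rfl⟩ := HomotopyCategory.quotient_obj_surjective E
  obtain ⟨f, rfl⟩ := (HomotopyCategory.quotient _ _).map_surjective f
  exact (HomotopyCategory.quotient_map_eq_zero_iff f).2 (h E hE f)

lemma pureKProjective_of_isZero (N : ℤ) (hN : ∀ i, N ≤ i → IsZero (X.X i))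
    (hX : ∀ i, IsPureProjective (X.X i)) :
    pureKProjective R ((HomotopyCategory.quotient _ _).obj X) :=
  pureKProjective_iff.2 fun _ hE f =>
    nonempty_homotopy_zero_of_isZero N hN hX (isPureExact_iff_homExactAt.1 hE) f

lemma forall_mem_coboundaries_iff {n : ℤ} :
    (∀ z : Cocycle X Y n, z ∈ coboundaries X Y n) ↔
      ∀ g : (HomotopyCategory.quotient _ (.up ℤ)).obj X ⟶
        (HomotopyCategory.quotient _ (.up ℤ)).obj (Y⟦n⟧), g = 0 := by
  refine ⟨fun h g => ?_, fun h z => (CohomologyClass.toHom_mk_eq_zero_iff z).1 (h _)⟩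
  obtain ⟨c, rfl⟩ := (CohomologyClass.toHom_bijective X Y n).2 g
  obtain ⟨z, rfl⟩ := c.mk_surjective
  exact (CohomologyClass.toHom_mk_eq_zero_iff z).2 (h z)

lemma pureKProjective_iff_mem_coboundaries :
    pureKProjective R ((HomotopyCategory.quotient _ _).obj X) ↔
      ∀ E : CochainComplex (ModuleCat.{v} R) ℤ, IsPureExact E →
        ∀ (n : ℤ) (z : Cocycle X E n), z ∈ coboundaries X E n := by
  refine ⟨fun h E hE n => forall_mem_coboundaries_iff.2 fun g => h g (hE.shift n),
    fun h => pureKProjective_iff.2 fun E hE f => ?_⟩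
  obtain ⟨β, hβ⟩ := (mem_coboundaries_iff (Cocycle.ofHom f) (-1) (by lia)).1 (h E hE 0 _)
  exact ⟨(Cochain.equivHomotopy f 0).symm ⟨β, by simpa using hβ.symm⟩⟩

end PureExactComplexes

/-! ### Pure K-projectivity and the total Hom complex -/

section Solutions

variable {R : Type w} [Ring R] {A B C : Type*} [AddCommGroup A] [Module R A] [AddCommGroup B]
  [Module R B] [AddCommGroup C] [Module R C] {f : A →ₗ[R] B} {g : B →ₗ[R] C} {m n : ℕ}

lemma HomExact.of_finite (h : HomExact f g) {ι κ : Type*} [Finite ι] [Fintype κ]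
    (a : ι → κ → R) (x : κ → B) (hx : ∀ i, ∑ j, a i j • x j = 0) (hg : ∀ j, g (x j) = 0) :
    ∃ y : κ → A, (∀ i, ∑ j, a i j • y j = 0) ∧ ∀ j, f (y j) = x j := by
  have e := Finite.equivFin ι
  have e' := Fintype.equivFin κ
  obtain ⟨y, hy, hyx⟩ := h _ _ (fun i j => a (e.symm i) (e'.symm j)) (fun j => x (e'.symm j))
    (fun i => (e'.symm.sum_comp fun j => a (e.symm i) j • x j).trans (hx _)) fun j => hg _
  refine ⟨fun j => y (e' j), fun i => ?_, fun j => by simp [hyx]⟩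
  rw [← hy (e i), ← e'.sum_comp]
  simp

variable (R A) in
/-- The `n`-tuples of elements of `A` which solve the homogeneous linear system with integral
matrix `a`, that is, `Hom_ℤ(F, A)` for the abelian group `F` presented by `a`. -/
def solutions (a : Fin m → Fin n → ℤ) : Submodule R (Fin n → A) where
  carrier := {x | ∀ i, ∑ j, a i j • x j = 0}
  add_mem' hx hy i := by simp [Finset.sum_add_distrib, hx i, hy i]
  zero_mem' i := by simp
  smul_mem' r x hx i := by simp [smul_comm _ r, ← Finset.smul_sum, hx i]

/-- The map `Hom_ℤ(F, A) → Hom_ℤ(F, B)` induced by a linear map `A → B`. -/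
def solutionsMap (a : Fin m → Fin n → ℤ) (f : A →ₗ[R] B) :
    solutions R A a →ₗ[R] solutions R B a :=
  (f.compLeft (Fin n)).restrict fun x hx i => by
    simpa using congrArg f (hx i)

/-- The system over `R` whose solutions in `A` are the solutions of `b` in `solutions R A a`: the
unknowns are the components of the unknowns of `b`. -/
def solutionSystem {p q : ℕ} (a : Fin m → Fin n → ℤ) (b : Fin p → Fin q → R) :
    (Fin p × Fin n) ⊕ (Fin m × Fin q) → Fin q × Fin n → R
  | .inl i, j => if i.2 = j.2 then b i.1 j.1 else 0
  | .inr i, j => if i.2 = j.1 then (a i.1 j.2 : R) else 0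

lemma solutionSystem_inl {p q : ℕ} (a : Fin m → Fin n → ℤ) (b : Fin p → Fin q → R)
    (z : Fin q × Fin n → A) (i : Fin p) (s : Fin n) :
    ∑ j, solutionSystem a b (.inl (i, s)) j • z j = ∑ j, b i j • z (j, s) := by
  simp [solutionSystem, Fintype.sum_prod_type, ite_smul]

lemma solutionSystem_inr {p q : ℕ} (a : Fin m → Fin n → ℤ) (b : Fin p → Fin q → R)
    (z : Fin q × Fin n → A) (i : Fin m) (t : Fin q) :
    ∑ j, solutionSystem a b (.inr (i, t)) j • z j = ∑ s, a i s • z (t, s) := by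
  simp [solutionSystem, Fintype.sum_prod_type_right, ite_smul, Int.cast_smul_eq_zsmul]

lemma HomExact.solutionsMap (h : HomExact f g) (a : Fin m → Fin n → ℤ) :
    HomExact (solutionsMap a f) (solutionsMap a g) := by
  intro p q b x hx hg
  have hx' (i : Fin p) (s : Fin n) : ∑ j, b i j • (x j).1 s = 0 := by
    simpa using congrFun (congrArg Subtype.val (hx i)) s
  obtain ⟨y, hy, hyx⟩ := h.of_finite (solutionSystem a b) (fun j => (x j.1).1 j.2)
    (by
      rintro (⟨i, s⟩ | ⟨i, t⟩)
      · exact (solutionSystem_inl ..).trans (hx' i s)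
      · exact (solutionSystem_inr ..).trans ((x t).2 i))
    fun j => congrFun (congrArg Subtype.val (hg j.1)) j.2
  have hb (i : Fin p) (s : Fin n) : ∑ j, b i j • y (j, s) = 0 :=
    (solutionSystem_inl a b y i s).symm.trans (hy (.inl (i, s)))
  refine ⟨fun t => ⟨fun s => y (t, s), fun i =>
      (solutionSystem_inr a b y i t).symm.trans (hy (.inr (i, t)))⟩,
    fun i => Subtype.ext (funext fun s => ?_),
    fun t => Subtype.ext (funext fun s => hyx (t, s))⟩
  simpa using hb i s

end Solutions

section HomComplex

open CochainComplex CochainComplex.HomComplex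

variable {R : Type w} [Ring R] {P E : CochainComplex (ModuleCat.{v} R) ℤ} {k : ℤ} {m n : ℕ}
  {a : Fin m → Fin n → ℤ}

/-- The complex `Hom_ℤ(F, E)`, where `F` is the abelian group presented by `a`. -/
def solutionComplex (E : CochainComplex (ModuleCat.{v} R) ℤ) (a : Fin m → Fin n → ℤ) :
    CochainComplex (ModuleCat.{v} R) ℤ where
  X k := ModuleCat.of R (solutions R (E.X k) a)
  d k l := ModuleCat.ofHom (solutionsMap a (E.d k l).hom)
  shape k l h := by
    exact ModuleCat.hom_ext (LinearMap.ext fun (x : solutions R (E.X k) a) =>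
      Subtype.ext (funext fun j => congr($(E.shape k l h).hom (x.1 j))))
  d_comp_d' k l r _ _ := by
    exact ModuleCat.hom_ext (LinearMap.ext fun (x : solutions R (E.X k) a) =>
      Subtype.ext (funext fun j => d_d_apply E k l r (x.1 j)))

lemma IsPureExact.solutionComplex (hE : IsPureExact E) (a : Fin m → Fin n → ℤ) :
    IsPureExact (solutionComplex E a) :=
  isPureExact_iff_homExactAt.2 fun k => (isPureExact_iff_homExactAt.1 hE k).solutionsMap a

/-- The projections from tuples to their components. -/
def solutionComplexProj (E : CochainComplex (ModuleCat.{v} R) ℤ) (a : Fin m → Fin n → ℤ)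
    (j : Fin n) : solutionComplex E a ⟶ E where
  f k := ModuleCat.ofHom (LinearMap.proj j ∘ₗ (solutions R (E.X k) a).subtype)

/-- The `j`-th component of a cochain with values in tuples. -/
def component (z : Cochain P (solutionComplex E a) k) (j : Fin n) : Cochain P E k :=
  z.comp (Cochain.ofHom (solutionComplexProj E a j)) (add_zero k)

lemma component_v (z : Cochain P (solutionComplex E a) k) (j : Fin n) {p q : ℤ} (h : p + k = q)
    (t : P.X p) : ((component z j).v p q h).hom t = ((z.v p q h).hom t).1 j := by
  rw [component, Cochain.comp_zero_cochain_v, Cochain.ofHom_v]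
  rfl

lemma component_injective {z z' : Cochain P (solutionComplex E a) k}
    (h : ∀ j, component z j = component z' j) : z = z' := by
  ext p q hpq t
  refine Subtype.ext (funext fun j => ?_)
  rw [← component_v, ← component_v, h]

lemma δ_component (z : Cochain P (solutionComplex E a) k) (l : ℤ) (j : Fin n) :
    δ k l (component z j) = component (δ k l z) j :=
  δ_comp_ofHom z _ l

/-- Evaluation of cochains at an element, as a homomorphism. -/
def evalCochain (k : ℤ) {p q : ℤ} (h : p + k = q) (t : P.X p) : Cochain P E k →+ E.X q :=
  AddMonoidHom.mk' (fun z => (z.v p q h).hom t) fun _ _ => rfl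

lemma sum_smul_eq_zero_iff (x : Fin n → Cochain P E k) (b : Fin n → ℤ) :
    ∑ j, b j • x j = 0 ↔
      ∀ (p q : ℤ) (h : p + k = q) (t : P.X p), ∑ j, b j • ((x j).v p q h).hom t = 0 := by
  have heval (p q : ℤ) (h : p + k = q) (t : P.X p) :
      evalCochain k h t (∑ j, b j • x j) = ∑ j, b j • ((x j).v p q h).hom t := by
    rw [map_sum]
    rfl
  refine ⟨fun hx p q h t => by rw [← heval, hx, map_zero], fun hx => ?_⟩
  ext p q h t
  exact (heval p q h t).trans (hx p q h t)

lemma sum_smul_component (z : Cochain P (solutionComplex E a) k) (i : Fin m) :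
    ∑ j, a i j • component z j = 0 := by
  refine (sum_smul_eq_zero_iff _ _).2 fun p q h t => ?_
  simp only [component_v]
  exact ((z.v p q h).hom t).2 i

lemma exists_component_eq (x : Fin n → Cochain P E k) (hx : ∀ i, ∑ j, a i j • x j = 0) :
    ∃ z : Cochain P (solutionComplex E a) k, ∀ j, component z j = x j := by
  refine ⟨Cochain.mk fun p q h => ModuleCat.ofHom
    ((LinearMap.pi fun j => ((x j).v p q h).hom).codRestrict (solutions R (E.X q) a)
      fun t i => (sum_smul_eq_zero_iff x (a i)).1 (hx i) p q h t), fun j => ?_⟩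
  ext p q h t
  rw [component_v]
  rfl

lemma isPureExact_homComplex_of_pureKProjective
    (hP : pureKProjective R ((HomotopyCategory.quotient _ _).obj P)) (hE : IsPureExact E) :
    IsPureExact (homComplex P E) := by
  refine isPureExact_iff_homExactAt.2 fun k m n a (x : Fin n → Cochain P E k) hx hd => ?_
  obtain ⟨z, hz⟩ := exists_component_eq x hx
  have hδz : δ k (k + 1) z = 0 := component_injective fun j => by
    rw [← δ_component, hz, component, Cochain.zero_comp]
    exact hd j
  obtain ⟨w, hw⟩ := (mem_coboundaries_iff (Cocycle.mk z (k + 1) rfl hδz) (k - 1) (by lia)).1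
    (pureKProjective_iff_mem_coboundaries.1 hP _ (hE.solutionComplex a) k _)
  exact ⟨component w, sum_smul_component w, fun j =>
    (δ_component w k j).trans (by rw [hw]; exact hz j)⟩

lemma PureProjRes.pureKProjective {X : CochainComplex (ModuleCat.{v} R) ℤ} (ρ : PureProjRes X) :
    pureKProjective R ((HomotopyCategory.quotient _ _).obj ρ.P) := by
  refine pureKProjective_iff_mem_coboundaries.2 fun E hE n z => ?_
  obtain ⟨y, hy⟩ := (isPureExact_iff_homExactAt.1 (ρ.preserves E hE) n).exists_eq z.1
    (z.δ_eq_zero (n + 1))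
  exact (mem_coboundaries_iff z (n - 1) (by lia)).2 ⟨y, hy⟩

lemma isZero_homology_homComplex_iff {n : ℤ} :
    IsZero ((homComplex P E).homology n) ↔ ∀ z : Cocycle P E n, z ∈ coboundaries P E n := by
  rw [← HomologicalComplex.exactAt_iff_isZero_homology,
    HomologicalComplex.exactAt_iff' _ (n - 1) n (n + 1) (by simp) (by simp),
    ShortComplex.moduleCat_exact_iff]
  refine ⟨fun h z => ?_, fun h x hx => ?_⟩
  · obtain ⟨y, hy⟩ := h z.1 (z.δ_eq_zero (n + 1))
    exact (mem_coboundaries_iff z (n - 1) (by lia)).2 ⟨y, hy⟩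
  · exact (mem_coboundaries_iff (Cocycle.mk x (n + 1) rfl hx) (n - 1) (by lia)).1 (h _)

end HomComplex

/-! ### Pure covers and resolutions -/

section PureCover

variable {R : Type u} [Ring R]

/-- The module with generators indexed by `Fin n` and relations the rows of `a`. -/
def presentedModule {m n : ℕ} (a : Fin m → Fin n → R) : ModuleCat.{u} R :=
  ModuleCat.of R ((Fin n → R) ⧸ Submodule.span R (Set.range a))

/-- The generators of a presented module. -/
def presentedModule.gen {m n : ℕ} (a : Fin m → Fin n → R) (j : Fin n) : presentedModule a :=
  (Submodule.span R (Set.range a)).mkQ (Pi.single j 1)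

/-- The map out of a presented module given by a solution of the corresponding linear system. -/
def presentedModule.desc {m n : ℕ} {a : Fin m → Fin n → R} {N : ModuleCat.{u} R} (x : Fin n → N)
    (h : ∀ i, ∑ j, a i j • x j = 0) : presentedModule a ⟶ N :=
  ModuleCat.ofHom <| Submodule.liftQ _ (Fintype.linearCombination R x) <| by
    rw [Submodule.span_le]
    rintro _ ⟨i, rfl⟩
    exact h i

section

variable {m n : ℕ} {a : Fin m → Fin n → R} {N : ModuleCat.{u} R}

lemma presentedModule.desc_gen (x : Fin n → N) (h : ∀ i, ∑ j, a i j • x j = 0) (j : Fin n) :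
    (desc x h).hom (gen a j) = x j := by
  change Fintype.linearCombination R x (Pi.single j 1) = _
  simp [Fintype.linearCombination_apply, Pi.single_apply]

lemma presentedModule.hom_ext {f g : presentedModule a ⟶ N}
    (h : ∀ j, f.hom (gen a j) = g.hom (gen a j)) : f = g := by
  refine ModuleCat.hom_ext (Submodule.linearMap_qext _ (LinearMap.pi_ext' fun j => ?_))
  exact LinearMap.ext_ring (h j)

lemma presentedModule.sum_smul_gen (i : Fin m) : ∑ j, a i j • gen a j = 0 := by
  have h := map_sum (Submodule.span R (Set.range a)).mkQ
    (fun j => a i j • (Pi.single j 1 : Fin n → R)) Finset.univ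
  have ha : ∑ j, a i j • (Pi.single j 1 : Fin n → R) = a i := by
    ext k
    simp [Finset.sum_apply, Pi.single_apply]
  simp only [map_smul, ha] at h
  refine h.symm.trans ?_
  exact (Submodule.Quotient.mk_eq_zero _).2 (Submodule.subset_span ⟨i, rfl⟩)

lemma presentedModule.sum_smul_apply_gen (f : presentedModule a ⟶ N) (i : Fin m) :
    ∑ j, a i j • f.hom (gen a j) = 0 := by
  simp only [← map_smul, ← map_sum, sum_smul_gen, map_zero]

lemma isPureProjective_presentedModule (a : Fin m → Fin n → R) :
    IsPureProjective (presentedModule a) := fun S hS g => by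
  obtain ⟨b, hb, hb'⟩ := (isPureShortExact_iff_liftsSystems.1 hS).2 m n a
    (fun j => g.hom (presentedModule.gen a j)) (presentedModule.sum_smul_apply_gen g)
  refine ⟨presentedModule.desc b hb, presentedModule.hom_ext fun j => ?_⟩
  rw [ModuleCat.hom_comp, LinearMap.comp_apply, presentedModule.desc_gen, hb']

end

/-- The finite linear systems with a solution in `N`, that is, the maps from finitely presented
modules to `N`. -/
structure SolvedSystem (N : ModuleCat.{u} R) where
  m : ℕ
  n : ℕ
  a : Fin m → Fin n → R
  x : Fin n → N
  sum_eq_zero : ∀ i, ∑ j, a i j • x j = 0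

/-- A pure projective module with a pure epimorphism to `N`: the direct sum of all finitely
presented modules mapping to `N`, one summand for each map. -/
def pureCover (N : ModuleCat.{u} R) : ModuleCat.{u} R :=
  ∐ fun s : SolvedSystem N => presentedModule s.a

/-- The pure epimorphism from the pure cover, given by the solutions. -/
def pureCoverπ (N : ModuleCat.{u} R) : pureCover N ⟶ N :=
  Sigma.desc fun s => presentedModule.desc s.x s.sum_eq_zero

lemma isPureProjective_pureCover (N : ModuleCat.{u} R) : IsPureProjective (pureCover N) :=
  isPureProjective_sigma fun s => isPureProjective_presentedModule s.a

lemma liftsSystems_pureCoverπ (N : ModuleCat.{u} R) : LiftsSystems (pureCoverπ N).hom := by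
  intro m n a x hx
  let s : SolvedSystem N := ⟨m, n, a, x, hx⟩
  let ι : presentedModule a ⟶ pureCover N :=
    Sigma.ι (fun s : SolvedSystem N => presentedModule s.a) s
  refine ⟨fun j => ι.hom (presentedModule.gen a j), presentedModule.sum_smul_apply_gen ι,
    fun j => ?_⟩
  have : ι ≫ pureCoverπ N = presentedModule.desc x hx := Sigma.ι_desc _ s
  rw [← LinearMap.comp_apply, ← ModuleCat.hom_comp, this, presentedModule.desc_gen]

end PureCover

section Orthogonality

open CochainComplex CochainComplex.HomComplex

variable {R : Type u} [Ring R]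

lemma pureKProjective_single {F : ModuleCat.{u} R} (hF : IsPureProjective F) (k : ℤ) :
    pureKProjective R ((HomotopyCategory.quotient _ _).obj
      ((CochainComplex.singleFunctor (ModuleCat.{u} R) k).obj F)) := by
  refine pureKProjective_of_isZero (k + 1)
    (fun i hi => HomologicalComplex.isZero_single_obj_X _ _ _ _ (by lia)) fun i => ?_
  by_cases hi : i = k
  · subst hi
    exact hF.of_retract (.ofIso (HomologicalComplex.singleObjXSelf (.up ℤ) i F))
  · exact .of_isZero (HomologicalComplex.isZero_single_obj_X _ _ _ _ hi)

variable (R) in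
lemma pureExactComplexes_eq_rightOrthogonal :
    pureExactComplexes.{u, u} R = (pureKProjective R).rightOrthogonal := by
  ext E
  refine ⟨fun hE P f hP => hP f hE, fun h => ?_⟩
  obtain ⟨E, rfl⟩ := HomotopyCategory.quotient_obj_surjective E
  change IsPureExact E
  refine isPureExact_iff_homExactAt.2 fun k m n a x hx hd => ?_
  let φ : presentedModule a ⟶ E.X k := presentedModule.desc x hx
  have hφ : φ ≫ E.d k (k + 1) = 0 := presentedModule.hom_ext fun j =>
    (congrArg (E.d k (k + 1)).hom (presentedModule.desc_gen x hx j)).trans (hd j)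
  have hz := forall_mem_coboundaries_iff.2
    (fun g => (pureKProjective R).rightOrthogonal.prop_of_iso
      (((HomotopyCategory.quotient _ (.up ℤ)).commShiftIso (k : ℤ)).symm.app E)
      ((pureKProjective R).rightOrthogonal.le_shift k _ h) g
        (pureKProjective_single (isPureProjective_presentedModule a) 0))
    (Cocycle.fromSingleMk φ (zero_add k) (k + 1) rfl hφ)
  obtain ⟨ψ, hψ⟩ := (Cocycle.fromSingleMk_mem_coboundaries_iff φ (zero_add k) (k + 1) rfl hφ
    (k - 1) (by lia)).1 hz
  refine ⟨fun j => ψ.hom (presentedModule.gen a j), presentedModule.sum_smul_apply_gen ψ,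
    fun j => ?_⟩
  rw [← LinearMap.comp_apply, ← ModuleCat.hom_comp, hψ, presentedModule.desc_gen]

variable (R) in
instance : (pureExactComplexes.{u, u} R).IsTriangulated := by
  rw [pureExactComplexes_eq_rightOrthogonal]
  infer_instance

lemma isPureQuasiIso_iff_trW {X Y : CochainComplex (ModuleCat.{u} R) ℤ} (f : X ⟶ Y) :
    IsPureQuasiIso f ↔ (pureExactComplexes R).trW ((HomotopyCategory.quotient _ _).map f) := by
  have hT := HomotopyCategory.mappingCone_triangleh_distinguished f
  constructor
  · intro h
    exact ObjectProperty.trW.mk _ hT h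
  · rintro ⟨Z, g, h, hT', hZ⟩
    let e := Pretriangulated.isoTriangleOfIso₁₂ _ _ hT' hT (Iso.refl _) (Iso.refl _)
      ((Category.comp_id _).trans (Category.id_comp _).symm)
    exact (pureExactComplexes R).prop_of_iso (Pretriangulated.Triangle.π₃.mapIso e) hZ

lemma trW_of_isIso_map {X Y : HomotopyCategory (ModuleCat.{u} R) (ComplexShape.up ℤ)}
    (g : X ⟶ Y) (hg : IsIso ((pureExactComplexes R).trW.Q.map g)) :
    (pureExactComplexes R).trW g := by
  obtain ⟨Z, p, q, hT⟩ := Pretriangulated.distinguished_cocone_triangle g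
  refine ⟨Z, p, q, hT, ?_⟩
  have hZ : IsZero ((pureExactComplexes R).trW.Q.obj Z) :=
    (Pretriangulated.Triangle.isZero₃_iff_isIso₁ _
      ((pureExactComplexes R).trW.Q.map_distinguished _ hT)).2 hg
  rw [pureExactComplexes_eq_rightOrthogonal]
  intro P φ hP
  exact (ObjectProperty.leftOrthogonal.map_bijective_of_isTriangulated hP
    (pureExactComplexes R).trW.Q Z).1 (hZ.eq_of_tgt _ _)

end Orthogonality

section Resolution

variable {R : Type u} [Ring R] (B : CochainComplex (ModuleCat.{u} R) ℤ)

/-- One step of the construction of a resolution `P → B` in negative degrees: `P` is the module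
`P^{-k}` and `W` stands for the module of pairs in `P^{-k} × B^{-(k+1)}` which are cycles of the
mapping cone, with its two projections `p` and `q`. A pure cover of `W` becomes `P^{-(k+1)}`. -/
structure ResolutionStage (k : ℕ) where
  P : ModuleCat.{u} R
  W : ModuleCat.{u} R
  p : W ⟶ P
  q : W ⟶ B.X (Int.negSucc k)

/-- The cycles of the mapping cone in `P^{-(k+1)} × B^{-(k+2)}`, for the pure cover
`P^{-(k+1)}` of the module of cycles of the stage `s`. -/
def ResolutionStage.cycles {B : CochainComplex (ModuleCat.{u} R) ℤ} {k : ℕ}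
    (s : ResolutionStage B k) : Submodule R (pureCover s.W × B.X (Int.negSucc (k + 1))) :=
  LinearMap.ker (s.p.hom ∘ₗ (pureCoverπ s.W).hom ∘ₗ LinearMap.fst R _ _) ⊓
    LinearMap.eqLocus (s.q.hom ∘ₗ (pureCoverπ s.W).hom ∘ₗ LinearMap.fst R _ _)
      ((B.d _ _).hom ∘ₗ LinearMap.snd R _ _)

/-- The stages of the resolution of a complex `B` concentrated in negative degrees. -/
def resolutionStage : (k : ℕ) → ResolutionStage B k
  | 0 => ⟨ModuleCat.of R PUnit, B.X (Int.negSucc 0), 0, 𝟙 _⟩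
  | k + 1 =>
    ⟨pureCover (resolutionStage k).W, ModuleCat.of R (resolutionStage k).cycles,
      ModuleCat.ofHom (LinearMap.fst R _ _ ∘ₗ Submodule.subtype _),
      ModuleCat.ofHom (LinearMap.snd R _ _ ∘ₗ Submodule.subtype _)⟩

/-- The modules of the resolution. -/
def resolutionX : ℤ → ModuleCat.{u} R
  | Int.ofNat _ => ModuleCat.of R PUnit
  | Int.negSucc k => pureCover (resolutionStage B k).W

/-- The first projection of the module of cycles, with values in the module of the resolution;
the latter is `0` in degree `0`. -/
def resolutionP : (k : ℕ) → ((resolutionStage B k).W ⟶ resolutionX B (Int.negSucc k + 1))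
  | 0 => 0
  | k + 1 => (resolutionStage B (k + 1)).p

/-- The differential of the resolution. -/
def resolutionD : (n : ℤ) → (resolutionX B n ⟶ resolutionX B (n + 1))
  | Int.ofNat _ => 0
  | Int.negSucc k => pureCoverπ _ ≫ resolutionP B k

/-- The components of the augmentation of the resolution. -/
def resolutionF : (n : ℤ) → (resolutionX B n ⟶ B.X n)
  | Int.ofNat _ => 0
  | Int.negSucc k => pureCoverπ _ ≫ (resolutionStage B k).q

lemma resolutionP_comp_D (k : ℕ) :
    resolutionP B k ≫ resolutionD B (Int.negSucc k + 1) = 0 := by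
  rcases k with _ | _ | k
  · exact zero_comp
  · refine ModuleCat.hom_ext (LinearMap.ext fun w => ?_)
    rfl
  · refine ModuleCat.hom_ext (LinearMap.ext fun w => ?_)
    exact w.2.1

lemma resolutionD_comp (n : ℤ) : resolutionD B n ≫ resolutionD B (n + 1) = 0 := by
  rcases n with n | k
  · exact zero_comp
  · change (pureCoverπ _ ≫ resolutionP B k) ≫ _ = 0
    rw [Category.assoc, resolutionP_comp_D, comp_zero]

lemma resolutionP_comp_F (hB : ∀ i, 0 ≤ i → IsZero (B.X i)) (k : ℕ) :
    resolutionP B k ≫ resolutionF B (Int.negSucc k + 1) =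
      (resolutionStage B k).q ≫ B.d (Int.negSucc k) (Int.negSucc k + 1) := by
  rcases k with _ | k
  · exact (hB _ (by decide)).eq_of_tgt _ _
  · refine ModuleCat.hom_ext (LinearMap.ext fun w => ?_)
    exact w.2.2

lemma resolutionF_comm (hB : ∀ i, 0 ≤ i → IsZero (B.X i)) (n : ℤ) :
    resolutionF B n ≫ B.d n (n + 1) = resolutionD B n ≫ resolutionF B (n + 1) := by
  rcases n with n | k
  · exact (hB _ (by lia)).eq_of_tgt _ _
  · change (pureCoverπ _ ≫ (resolutionStage B k).q) ≫ _ = (pureCoverπ _ ≫ resolutionP B k) ≫ _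
    rw [Category.assoc, Category.assoc, resolutionP_comp_F B hB]

lemma resolutionStage_ext (k : ℕ) (w : (resolutionStage B k).W)
    (hp : (resolutionP B k).hom w = 0) (hq : (resolutionStage B k).q.hom w = 0) : w = 0 := by
  rcases k with _ | k
  · exact hq
  · exact Subtype.ext (Prod.ext hp hq)

lemma resolutionStage_exists (k : ℕ) (p : resolutionX B (Int.negSucc k + 1))
    (b : B.X (Int.negSucc k)) (hp : (resolutionD B _).hom p = 0)
    (hb : (resolutionF B _).hom p = (B.d (Int.negSucc k) (Int.negSucc k + 1)).hom b) :
    ∃ w, (resolutionP B k).hom w = p ∧ (resolutionStage B k).q.hom w = b := by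
  rcases k with _ | _ | k
  · exact ⟨b, rfl, rfl⟩
  · exact ⟨⟨(p, b), rfl, hb⟩, rfl, rfl⟩
  · exact ⟨⟨(p, b), hp, hb⟩, rfl, rfl⟩

/-- The resolution of a complex concentrated in negative degrees. -/
def resolution : CochainComplex (ModuleCat.{u} R) ℤ :=
  CochainComplex.of (resolutionX B) (resolutionD B) (resolutionD_comp B)

lemma resolution_d (n : ℤ) : (resolution B).d n (n + 1) = resolutionD B n :=
  CochainComplex.of_d ..

/-- The augmentation of the resolution. -/
def resolutionHom (hB : ∀ i, 0 ≤ i → IsZero (B.X i)) : resolution B ⟶ B where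
  f := resolutionF B
  comm' i j h := by
    obtain rfl : i + 1 = j := h
    rw [resolution_d]
    exact resolutionF_comm B hB i

lemma resolution_isPureProjective (i : ℤ) : IsPureProjective ((resolution B).X i) := by
  rcases i with i | k
  · exact .of_isZero (ModuleCat.isZero_of_subsingleton (ModuleCat.of R PUnit))
  · exact isPureProjective_pureCover _

lemma resolution_isZero (i : ℤ) (hi : 0 ≤ i) : IsZero ((resolution B).X i) := by
  rcases i with i | k
  · exact ModuleCat.isZero_of_subsingleton (ModuleCat.of R PUnit)
  · exact absurd hi (by simp)

lemma resolution_isPureQuasiIso (hB : ∀ i, 0 ≤ i → IsZero (B.X i)) :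
    IsPureQuasiIso (resolutionHom B hB) := by
  refine isPureQuasiIso_of_exists fun i m n a p b hp hb hdp hpb => ?_
  rcases i with i | k
  · have := ModuleCat.subsingleton_of_isZero (resolution_isZero B (Int.ofNat i + 1) (by lia))
    have := ModuleCat.subsingleton_of_isZero (hB (Int.ofNat i) (by lia))
    exact ⟨0, by simp, fun j => ⟨Subsingleton.elim _ _, Subsingleton.elim _ _⟩⟩
  rw [resolution_d] at hdp ⊢
  choose w hwp hwb using fun j => resolutionStage_exists B k (p j) (b j) (hdp j) (hpb j)
  obtain ⟨y, hy, hyw⟩ := liftsSystems_pureCoverπ (resolutionStage B k).W m n a w fun s =>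
    resolutionStage_ext B k _ (by simp only [map_sum, map_smul, hwp]; exact hp s)
      (by simp only [map_sum, map_smul, hwb, hb])
  exact ⟨y, hy, fun j => ⟨(congrArg (resolutionP B k).hom (hyw j)).trans (hwp j),
    (congrArg (resolutionStage B k).q.hom (hyw j)).trans (hwb j)⟩⟩

end Resolution

section Existence

variable {R : Type u} [Ring R] {X Y : CochainComplex (ModuleCat.{u} R) ℤ}

/-- The pure projective resolution given by a map `f : P ⟶ X` which becomes invertible in the pure
derived category, for a pure K-projective complex `P` of pure projective modules. -/
def PureProjRes.ofTrW (P : CochainComplex (ModuleCat.{u} R) ℤ) (f : P ⟶ X)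
    (hf : (pureExactComplexes R).trW ((HomotopyCategory.quotient _ _).map f))
    (hP : ∀ i, IsPureProjective (P.X i))
    (hK : PureDerived.pureKProjective R ((HomotopyCategory.quotient _ _).obj P)) :
    PureProjRes X where
  P := P
  f := f
  isPureQuasiIso := (isPureQuasiIso_iff_trW f).2 hf
  isPureProjective := hP
  preserves _ hE := isPureExact_homComplex_of_pureKProjective hK hE

/-- The shift of a pure projective resolution. -/
def PureProjRes.shift (ρ : PureProjRes X) (n : ℤ) : PureProjRes (X⟦n⟧) :=
  .ofTrW (ρ.P⟦n⟧) (ρ.f⟦n⟧')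
    ((MorphismProperty.arrow_mk_iso_iff _
      (Arrow.isoOfNatIso ((HomotopyCategory.quotient _ (.up ℤ)).commShiftIso n) (.mk ρ.f))).2
      (((isPureQuasiIso_iff_trW ρ.f).1 ρ.isPureQuasiIso).shift n))
    (fun i => ρ.isPureProjective (i + n))
    ((PureDerived.pureKProjective R).prop_of_iso
      (((HomotopyCategory.quotient _ (.up ℤ)).commShiftIso n).symm.app ρ.P)
      ((PureDerived.pureKProjective R).le_shift n _ ρ.pureKProjective))

lemma PureProjRes.nonempty_of_iso (ρ : PureProjRes Y) (e : (toDPur R).obj X ≅ (toDPur R).obj Y) :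
    Nonempty (PureProjRes X) := by
  let q := HomotopyCategory.quotient (ModuleCat.{u} R) (.up ℤ)
  let L := (pureExactComplexes.{u, u} R).trW.Q
  have hρ : IsIso (L.map (q.map ρ.f)) := Localization.inverts L (pureExactComplexes R).trW _
    ((isPureQuasiIso_iff_trW ρ.f).1 ρ.isPureQuasiIso)
  obtain ⟨g, hg⟩ := (ObjectProperty.leftOrthogonal.map_bijective_of_isTriangulated
    ρ.pureKProjective L (q.obj X)).2 (L.map (q.map ρ.f) ≫ e.inv)
  obtain ⟨g, rfl⟩ := q.map_surjective g
  have hiso : IsIso (L.map (q.map g)) := hg ▸ IsIso.comp_isIso' hρ e.isIso_inv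
  exact ⟨.ofTrW ρ.P g (trW_of_isIso_map _ hiso) ρ.isPureProjective ρ.pureKProjective⟩

lemma nonempty_pureProjRes_of_isZero (N : ℤ) (hX : ∀ i, N < i → IsZero (X.X i)) :
    Nonempty (PureProjRes X) := by
  have hX' (i : ℤ) (hi : 0 ≤ i) : IsZero ((X⟦N + 1⟧).X i) := hX (i + (N + 1)) (by lia)
  let ρ : PureProjRes (X⟦N + 1⟧) :=
    { P := resolution (X⟦N + 1⟧)
      f := resolutionHom _ hX'
      isPureQuasiIso := resolution_isPureQuasiIso _ hX'
      isPureProjective := resolution_isPureProjective _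
      preserves := fun _ hE => isPureExact_homComplex_of_pureKProjective
        (pureKProjective_of_isZero 0 (resolution_isZero _) (resolution_isPureProjective _)) hE }
  exact (ρ.shift (-(N + 1))).nonempty_of_iso
    ((toDPur R).mapIso ((shiftEquiv _ (N + 1)).unitIso.app X))

lemma InDbPur.nonempty_pureProjRes (hX : InDbPur X) : Nonempty (PureProjRes X) := by
  obtain ⟨B, ⟨_, N, hB⟩, ⟨e⟩⟩ := hX
  obtain ⟨ρ⟩ := nonempty_pureProjRes_of_isZero N fun i hi => hB i (.inr hi)
  exact ρ.nonempty_of_iso e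

end Existence

section Comparison

open CochainComplex CochainComplex.HomComplex

variable {R : Type u} [Ring R] {X Y : CochainComplex (ModuleCat.{u} R) ℤ}

lemma PureProjRes.nonempty_quotient_obj_iso (ρ σ : PureProjRes X) :
    Nonempty ((HomotopyCategory.quotient _ (.up ℤ)).obj ρ.P ≅
      (HomotopyCategory.quotient _ (.up ℤ)).obj σ.P) := by
  let q := HomotopyCategory.quotient (ModuleCat.{u} R) (.up ℤ)
  have hρ := (isPureQuasiIso_iff_trW ρ.f).1 ρ.isPureQuasiIso
  have hσ := (isPureQuasiIso_iff_trW σ.f).1 σ.isPureQuasiIso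
  have hρP := ρ.pureKProjective
  have hσP := σ.pureKProjective
  rw [PureDerived.pureKProjective, ← ObjectProperty.isColocal_trW] at hρP hσP
  obtain ⟨α, hα : α ≫ q.map σ.f = q.map ρ.f⟩ := (hρP _ hσ).2 (q.map ρ.f)
  obtain ⟨β, hβ : β ≫ q.map ρ.f = q.map σ.f⟩ := (hσP _ hρ).2 (q.map σ.f)
  exact ⟨{
    hom := α
    inv := β
    hom_inv_id := (hρP _ hρ).1 (by
      beta_reduce
      rw [Category.assoc, hβ, hα, Category.id_comp])
    inv_hom_id := (hσP _ hσ).1 (by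
      beta_reduce
      rw [Category.assoc, hα, hβ, Category.id_comp]) }⟩

lemma PureProjRes.forall_mem_coboundaries (ρ σ : PureProjRes X) (n : ℤ)
    (h : ∀ z : Cocycle ρ.P Y n, z ∈ coboundaries ρ.P Y n) :
    ∀ z : Cocycle σ.P Y n, z ∈ coboundaries σ.P Y n := by
  rw [forall_mem_coboundaries_iff] at h ⊢
  obtain ⟨e⟩ := ρ.nonempty_quotient_obj_iso σ
  intro g
  rw [← e.inv_hom_id_assoc g, h (e.hom ≫ g), comp_zero]

lemma isZero_pext_iff (ρ : PureProjRes X) (n : ℤ) :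
    IsZero (Pext n X Y) ↔ ∀ z : Cocycle ρ.P Y n, z ∈ coboundaries ρ.P Y n := by
  have h : Nonempty (PureProjRes X) := ⟨ρ⟩
  rw [Pext, dif_pos h, isZero_homology_homComplex_iff]
  exact ⟨h.some.forall_mem_coboundaries ρ n, ρ.forall_mem_coboundaries h.some n⟩

end Comparison

/-! ### Vanishing of cohomology -/

section Subcomplex

variable {R : Type w} [Ring R]

/-- A subcomplex of a complex of modules, given by a family of submodules. -/
structure Subcomplex (Y : CochainComplex (ModuleCat.{v} R) ℤ) where
  submodule (k : ℤ) : Submodule R (Y.X k)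
  d_mem (k : ℤ) (y : Y.X k) : y ∈ submodule k → (Y.d k (k + 1)).hom y ∈ submodule (k + 1)

namespace Subcomplex

variable {Y : CochainComplex (ModuleCat.{v} R) ℤ} (S : Subcomplex Y)

lemma le_comap (k l : ℤ) : S.submodule k ≤ (S.submodule l).comap (Y.d k l).hom := by
  intro y hy
  by_cases hkl : k + 1 = l
  · subst hkl
    exact S.d_mem k y hy
  · rw [Y.shape k l hkl]
    exact (S.submodule l).zero_mem

/-- The quotient of a complex by a subcomplex. -/
def quotient : CochainComplex (ModuleCat.{v} R) ℤ where
  X k := ModuleCat.of R (Y.X k ⧸ S.submodule k)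
  d k l := ModuleCat.ofHom ((S.submodule k).mapQ (S.submodule l) (Y.d k l).hom (S.le_comap k l))
  shape k l h := ModuleCat.hom_ext (Submodule.linearMap_qext _ (LinearMap.ext fun y =>
    congrArg Submodule.Quotient.mk congr($(Y.shape k l h).hom y)))
  d_comp_d' i j k _ _ := ModuleCat.hom_ext (Submodule.linearMap_qext _ (LinearMap.ext fun y =>
    congrArg Submodule.Quotient.mk (d_d_apply Y i j k y)))

/-- The projection to the quotient by a subcomplex. -/
def π : Y ⟶ S.quotient where
  f k := ModuleCat.ofHom (S.submodule k).mkQ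

lemma π_eq_zero_iff {k : ℤ} (y : Y.X k) : (S.π.f k).hom y = 0 ↔ y ∈ S.submodule k :=
  Submodule.Quotient.mk_eq_zero _

lemma π_surjective (k : ℤ) : Function.Surjective (S.π.f k).hom :=
  Submodule.mkQ_surjective _

variable (Y)

/-- The canonical truncation in degrees less than `m`: everything in degrees less than `m - 1`,
the cocycles in degree `m - 1`, and zero in higher degrees. -/
def truncCocycles (m : ℤ) : Subcomplex Y where
  submodule k :=
    { carrier := {y | (m ≤ k → y = 0) ∧ (m ≤ k + 1 → (Y.d k (k + 1)).hom y = 0)}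
      add_mem' hx hy := ⟨fun h => by rw [hx.1 h, hy.1 h, add_zero],
        fun h => by rw [map_add, hx.2 h, hy.2 h, add_zero]⟩
      zero_mem' := by simp
      smul_mem' r y hy := ⟨fun h => by rw [hy.1 h, smul_zero],
        fun h => by rw [map_smul, hy.2 h, smul_zero]⟩ }
  d_mem _ _ hy := ⟨hy.2, fun _ => d_d_apply ..⟩

/-- Everything in degrees less than `m`, the coboundaries in degree `m`, and zero in higher
degrees. -/
def truncCoboundaries (m : ℤ) : Subcomplex Y where
  submodule k :=
    { carrier := {y | (m ≤ k → ∃ z, (Y.d (k - 1) k).hom z = y) ∧ (m < k → y = 0)}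
      add_mem' hx hy := ⟨fun h => by
          obtain ⟨z, rfl⟩ := hx.1 h
          obtain ⟨w, rfl⟩ := hy.1 h
          exact ⟨z + w, map_add ..⟩,
        fun h => by rw [hx.2 h, hy.2 h, add_zero]⟩
      zero_mem' := ⟨fun _ => ⟨0, map_zero _⟩, fun _ => rfl⟩
      smul_mem' r y hy := ⟨fun h => by
          obtain ⟨z, rfl⟩ := hy.1 h
          exact ⟨r • z, map_smul ..⟩,
        fun h => by rw [hy.2 h, smul_zero]⟩ }
  d_mem k y hy := by
    refine ⟨fun _ => ?_, fun h => ?_⟩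
    · rw [add_sub_cancel_right]
      exact ⟨y, rfl⟩
    · obtain ⟨z, rfl⟩ := hy.1 (by lia)
      exact d_d_apply ..

end Subcomplex

end Subcomplex

section Truncation

variable {R : Type w} [Ring R] {Y : CochainComplex (ModuleCat.{v} R) ℤ} {m : ℤ}

open Subcomplex

lemma truncCocycles_π_injective {k : ℤ} (hk : m ≤ k) :
    Function.Injective ((truncCocycles Y m).π.f k).hom :=
  (injective_iff_map_eq_zero _).2 fun _ hy => ((π_eq_zero_iff _ _).1 hy).1 hk

lemma liftsSystems_truncCocycles_π (hY : ∀ k, m ≤ k → HomExactAt Y k) (k : ℤ) :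
    LiftsSystems ((truncCocycles Y m).π.f k).hom := by
  intro p q a c hc
  choose b hb using fun j => (truncCocycles Y m).π_surjective k (c j)
  have hmem (i : Fin p) : ∑ j, a i j • b j ∈ (truncCocycles Y m).submodule k := by
    rw [← π_eq_zero_iff, ← hc i]
    simp only [map_sum, map_smul, hb]
  by_cases h₀ : m ≤ k
  · exact ⟨b, fun i => (hmem i).1 h₀, hb⟩
  by_cases h₁ : m ≤ k + 1
  · obtain ⟨b', hb', hd⟩ := ((hY (k + 1) h₁).homExact rfl rfl) p q a
      (fun j => (Y.d k (k + 1)).hom (b j)) (fun i => by simpa using (hmem i).2 h₁)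
      fun j => d_d_apply ..
    refine ⟨b', hb', fun j => ?_⟩
    rw [← hb, ← sub_eq_zero, ← map_sub, π_eq_zero_iff]
    exact ⟨fun h => absurd h h₀, fun _ => by rw [map_sub, hd, sub_self]⟩
  · refine ⟨0, by simp, fun j => ?_⟩
    rw [Pi.zero_apply, map_zero, eq_comm, ← hb, π_eq_zero_iff]
    exact ⟨fun h => absurd h h₀, fun h => absurd h h₁⟩

lemma isPureExact_truncCocycles_quotient (hY : ∀ k, m ≤ k → HomExactAt Y k) :
    IsPureExact (truncCocycles Y m).quotient := by
  refine isPureExact_iff_homExactAt.2 fun k p q a e he hd => ?_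
  obtain ⟨y, hy, hye⟩ := liftsSystems_truncCocycles_π hY k p q a e he
  have hdy (j : Fin q) : (Y.d k (k + 1)).hom (y j) ∈ (truncCocycles Y m).submodule (k + 1) := by
    rw [← π_eq_zero_iff, ← hom_comm_apply, hye, hd]
  by_cases h : m ≤ k
  · obtain ⟨w, hw, hdw⟩ := hY k h p q a y hy fun j => (hdy j).1 (by lia)
    refine ⟨fun j => ((truncCocycles Y m).π.f (k - 1)).hom (w j), fun i => ?_, fun j => ?_⟩
    · simp only [← map_smul, ← map_sum, hw, map_zero]
    · rw [hom_comm_apply, hdw, hye]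
  · refine ⟨0, by simp, fun j => ?_⟩
    rw [Pi.zero_apply, map_zero, eq_comm, ← hye, π_eq_zero_iff]
    exact ⟨fun h' => absurd h' h, (hdy j).1⟩

end Truncation

section Vanishing

open CochainComplex CochainComplex.HomComplex

variable {R : Type w} [Ring R] {P Y Z : CochainComplex (ModuleCat.{v} R) ℤ}

lemma exists_cochain_comp_eq (hP : ∀ k, IsPureProjective (P.X k)) (π : Y ⟶ Z)
    (hπ : ∀ k, LiftsSystems (π.f k).hom) {i : ℤ} (w : Cochain P Z i) :
    ∃ β : Cochain P Y i, β.comp (Cochain.ofHom π) (add_zero i) = w := by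
  choose β hβ using fun (p q : ℤ) (h : p + i = q) => (hP p).exists_lift (hπ q) (w.v p q h)
  refine ⟨Cochain.mk β, ?_⟩
  ext p q h : 1
  rw [Cochain.comp_zero_cochain_v, Cochain.ofHom_v]
  exact hβ p q h

lemma mem_coboundaries_of_isZero {n i : ℤ}
    (hK : pureKProjective R ((HomotopyCategory.quotient _ _).obj P))
    (hP : ∀ k, IsPureProjective (P.X k)) (hz : ∀ k, k < -n → IsZero (P.X k))
    (hY : ∀ k, i - n ≤ k → HomExactAt Y k) (z : Cocycle P Y i) : z ∈ coboundaries P Y i := by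
  let π := (Subcomplex.truncCocycles Y (i - n)).π
  obtain ⟨w, hw⟩ := (mem_coboundaries_iff (z.postcomp π) (i - 1) (sub_add_cancel i 1)).1
    (pureKProjective_iff_mem_coboundaries.1 hK _ (isPureExact_truncCocycles_quotient hY) i _)
  obtain ⟨β, hβ⟩ := exists_cochain_comp_eq hP π (liftsSystems_truncCocycles_π hY) w
  have hδβ : (δ (i - 1) i β).comp (Cochain.ofHom π) (add_zero i) =
      z.1.comp (Cochain.ofHom π) (add_zero i) := by
    rw [← δ_comp_ofHom, hβ, hw]
    rfl
  refine (mem_coboundaries_iff z (i - 1) (sub_add_cancel i 1)).2 ⟨β, ?_⟩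
  ext p q h t
  by_cases hp : p < -n
  · have := ModuleCat.subsingleton_of_isZero (hz p hp)
    rw [Subsingleton.elim t 0, map_zero, map_zero]
  · have hpq := congr(($(Cochain.congr_v hδβ p q h)).hom t)
    rw [Cochain.comp_zero_cochain_v, Cochain.comp_zero_cochain_v, Cochain.ofHom_v] at hpq
    exact truncCocycles_π_injective (by lia) hpq

lemma supP_stalk_le (N : ModuleCat.{v} R) : supP (stalk N) ≤ 0 := by
  suffices h : supP (stalk N) ≤ (((0 : ℤ) : ℝ) : EReal) by simpa using h
  have hsub (k : ℤ) (hk : 0 < k) : Subsingleton ((stalk N).X k) :=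
    ModuleCat.subsingleton_of_isZero (HomologicalComplex.isZero_single_obj_X _ _ _ _ hk.ne')
  have hexact (k : ℤ) (hk : 0 < k) : HomExactAt (stalk N) k := fun _ _ _ _ _ _ =>
    have := hsub k hk
    ⟨0, by simp, fun _ => Subsingleton.elim _ _⟩
  exact supP_le fun k hk => isPureExactAt_of_homExactAt (hexact _ hk) (hexact _ (by lia))
    (hexact _ (by lia))

lemma homExactAt_of_add_supP_lt {n i k : ℤ}
    (h : ((n : ℝ) : EReal) + supP Y < ((i : ℝ) : EReal)) (hk : i - n ≤ k) : HomExactAt Y k := by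
  refine (isPureExactAt_of_supP_lt (lt_of_not_ge fun hs => h.not_ge ?_)).homExactAt
  calc ((i : ℝ) : EReal) ≤ ((n : ℝ) : EReal) + ((k : ℝ) : EReal) := by
        rw [← EReal.coe_add, EReal.coe_le_coe_iff]
        exact_mod_cast sub_le_iff_le_add'.1 hk
    _ ≤ ((n : ℝ) : EReal) + supP Y := by gcongr

lemma exists_d_comp_eq_cokernel_π {i j k n : ℤ} (hn : j + n = 0) (hi : i + 1 = j)
    (hk : j + 1 = k) (h : ∀ z : Cocycle P (stalk (cokernel (P.d i j))) n, z ∈ coboundaries _ _ n) :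
    ∃ g : P.X k ⟶ cokernel (P.d i j), P.d j k ≫ g = cokernel.π (P.d i j) :=
  (Cocycle.toSingleMk_mem_coboundaries_iff (cokernel.π (P.d i j)) hn i hi
    (cokernel.condition _) k hk).1 (h _)

lemma cokernel_π_surjective {A B : ModuleCat.{v} R} (d : A ⟶ B) :
    Function.Surjective (cokernel.π d).hom :=
  (ModuleCat.epi_iff_surjective _).1 inferInstance

lemma cokernel_π_eq_zero_iff {A B : ModuleCat.{v} R} (d : A ⟶ B) (b : B) :
    (cokernel.π d).hom b = 0 ↔ ∃ a, d.hom a = b :=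
  (SetLike.ext_iff.1 (ker_cokernel_π d) b)

lemma tensorExactAt_of_d_comp_eq {k : ℤ} (g : P.X (k + 1) ⟶ cokernel (P.d (k - 1) k))
    (hg : P.d k (k + 1) ≫ g = cokernel.π (P.d (k - 1) k)) : TensorExactAt P k := by
  intro m n a x b hx
  choose y hy using fun j => cokernel_π_surjective (P.d (k - 1) k) (g.hom (b j))
  have hπ (s : Fin m) : (cokernel.π (P.d (k - 1) k)).hom (x s - ∑ j, a s j • y j) = 0 := by
    rw [map_sub, sub_eq_zero]
    calc (cokernel.π (P.d (k - 1) k)).hom (x s) = g.hom ((P.d k (k + 1)).hom (x s)) :=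
          congr($(hg.symm).hom (x s))
      _ = (cokernel.π (P.d (k - 1) k)).hom (∑ j, a s j • y j) := by simp [hx, hy]
  choose z hz using fun s => (cokernel_π_eq_zero_iff _ _).1 (hπ s)
  exact ⟨y, z, fun s => by rw [hz, add_sub_cancel]⟩

/-- The map `δ` induced by `d^j` on `Coker d^i` has the retraction `g`, and `Coker d^j = Coker δ`
is the image of the complementary projector `1 - g ≫ δ` of `P^k`. -/
lemma isPureProjective_cokernel_of_d_comp_eq {i j k : ℤ} (hP : IsPureProjective (P.X k))
    (g : P.X k ⟶ cokernel (P.d i j)) (hg : P.d j k ≫ g = cokernel.π (P.d i j)) :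
    IsPureProjective (cokernel (P.d j k)) := by
  let δ := cokernel.desc (P.d i j) (P.d j k) (P.d_comp_d i j k)
  have hδ : cokernel.π (P.d i j) ≫ δ = P.d j k := cokernel.π_desc ..
  have hδπ : δ ≫ cokernel.π (P.d j k) = 0 := by
    rw [← cancel_epi (cokernel.π (P.d i j)), ← Category.assoc, hδ, cokernel.condition, comp_zero]
  have hd : P.d j k ≫ (𝟙 _ - g ≫ δ) = 0 := by
    rw [Preadditive.comp_sub, Category.comp_id, ← Category.assoc, hg, hδ, sub_self]
  exact hP.of_retract
    { i := cokernel.desc (P.d j k) _ hd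
      r := cokernel.π _
      retract := by
        rw [← cancel_epi (cokernel.π (P.d j k)), cokernel.π_desc_assoc, Preadditive.sub_comp,
          Category.assoc, hδπ, comp_zero, sub_zero, Category.id_comp, Category.comp_id] }

end Vanishing

/-! ### Splitting off a contractible summand -/

section Splitting

open Subcomplex

/-- A split epimorphism splits its source into its target and its kernel. -/
def biprodKernelIso {C : Type*} [Category* C] [Preadditive C] [HasBinaryBiproducts C] {X Y : C}
    (f : X ⟶ Y) [IsSplitEpi f] [HasKernel f] : X ≅ Y ⊞ kernel f :=
  biprod.uniqueUpToIso _ _ (isBilimitBinaryBiconeOfIsSplitEpiOfKernel (kernelIsKernel f)) ≪≫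
    biprod.braiding _ _

/-- The kernel of a split epimorphism, as a retract of its source. -/
def retractKernel {C : Type*} [Category* C] [Preadditive C] {X Y : C}
    (f : X ⟶ Y) [IsSplitEpi f] [HasKernel f] : Retract (kernel f) X where
  i := kernel.ι f
  r := (binaryBiconeOfIsSplitEpiOfKernel (kernelIsKernel f)).fst
  retract := (binaryBiconeOfIsSplitEpiOfKernel (kernelIsKernel f)).inl_fst

variable {R : Type w} [Ring R] {P : CochainComplex (ModuleCat.{v} R) ℤ} {m : ℤ}

lemma mem_truncCoboundaries_of_lt {k : ℤ} (hk : k < m) (x : P.X k) :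
    x ∈ (truncCoboundaries P m).submodule k :=
  ⟨fun h => absurd h hk.not_ge, fun h => absurd h hk.not_gt⟩

lemma isZero_truncCoboundaries_quotient_X {k : ℤ} (hk : k < m) :
    IsZero ((truncCoboundaries P m).quotient.X k) := by
  have : Subsingleton ((truncCoboundaries P m).quotient.X k) :=
    ⟨((truncCoboundaries P m).π_surjective k).forall₂.2 fun x y => by
      rw [(π_eq_zero_iff _ _).2 (mem_truncCoboundaries_of_lt hk x),
        (π_eq_zero_iff _ _).2 (mem_truncCoboundaries_of_lt hk y)]⟩
  exact ModuleCat.isZero_of_subsingleton _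

lemma liftsSystems_cokernel_π {i j k : ℤ} (hi : i + 1 = j) (hk : j + 1 = k)
    (h : TensorExactAt P j) : LiftsSystems (cokernel.π (P.d j k)).hom := by
  intro p q a c hc
  choose b hb using fun t => cokernel_π_surjective (P.d j k) (c t)
  choose x hx using fun s => (cokernel_π_eq_zero_iff (P.d j k) (∑ t, a s t • b t)).1
    (by simp [hb, hc])
  obtain ⟨y, z, hyz⟩ := h.tensorExact hi hk p q a x b hx
  refine ⟨fun t => b t - (P.d j k).hom (y t), fun s => ?_, fun t => ?_⟩
  · simp [smul_sub, Finset.sum_sub_distrib, ← hx, hyz, d_d_apply]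
  · rw [map_sub, hb, (cokernel_π_eq_zero_iff _ _).2 ⟨y t, rfl⟩, sub_zero]

lemma isSplitEpi_truncCoboundaries_π_f_self (h : TensorExactAt P (m - 1))
    (hC : IsPureProjective (cokernel (P.d (m - 1) m))) :
    IsSplitEpi ((truncCoboundaries P m).π.f m) := by
  have hmem (x : P.X m) : x ∈ (truncCoboundaries P m).submodule m ↔
      (cokernel.π (P.d (m - 1) m)).hom x = 0 := by
    rw [cokernel_π_eq_zero_iff]
    exact ⟨fun hx => hx.1 le_rfl, fun hx => ⟨fun _ => hx, fun hm => absurd hm (lt_irrefl m)⟩⟩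
  let φ : (truncCoboundaries P m).quotient.X m ⟶ cokernel (P.d (m - 1) m) :=
    ModuleCat.ofHom (Submodule.liftQ _ (cokernel.π (P.d (m - 1) m)).hom fun x => (hmem x).1)
  obtain ⟨σ, hσ⟩ := hC.exists_lift
    (liftsSystems_cokernel_π (i := m - 1 - 1) (by lia) (by lia) h) (𝟙 _)
  refine .mk' ⟨φ ≫ σ, ModuleCat.hom_ext (Submodule.linearMap_qext _ (LinearMap.ext fun x => ?_))⟩
  refine (Submodule.Quotient.eq _).2 ((hmem _).2 ?_)
  rw [map_sub, sub_eq_zero]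
  exact congr($(hσ).hom ((cokernel.π (P.d (m - 1) m)).hom x))

lemma isSplitEpi_truncCoboundaries_π_f (h : TensorExactAt P (m - 1))
    (hC : IsPureProjective (cokernel (P.d (m - 1) m))) (k : ℤ) :
    IsSplitEpi ((truncCoboundaries P m).π.f k) := by
  obtain hk | rfl | hk := lt_trichotomy k m
  · exact .mk' ⟨0, (isZero_truncCoboundaries_quotient_X hk).eq_of_src _ _⟩
  · exact isSplitEpi_truncCoboundaries_π_f_self h hC
  · have hinj : Function.Injective ((truncCoboundaries P m).π.f k).hom :=
      (injective_iff_map_eq_zero _).2 fun x hx => ((π_eq_zero_iff _ _).1 hx).2 hk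
    have := (ConcreteCategory.isIso_iff_bijective _).2
      ⟨hinj, (truncCoboundaries P m).π_surjective k⟩
    infer_instance

/-- Degreewise sections commute with the differentials: the quotient vanishes in degrees less than
`m`, and in degrees at least `m` the differential of `P` vanishes on the subcomplex. -/
lemma isSplitEpi_truncCoboundaries_π
    (h : ∀ k, IsSplitEpi ((truncCoboundaries P m).π.f k)) :
    IsSplitEpi (truncCoboundaries P m).π := by
  let S := truncCoboundaries P m
  let s (k : ℤ) := section_ (S.π.f k)
  have hs (k : ℤ) (x : P.X k) : (s k).hom ((S.π.f k).hom x) - x ∈ S.submodule k := by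
    rw [← π_eq_zero_iff, map_sub, sub_eq_zero]
    exact congr($(IsSplitEpi.id (S.π.f k)).hom ((S.π.f k).hom x))
  refine .mk' ⟨{ f := s, comm' := fun i j hij => ?_ }, HomologicalComplex.hom_ext _ _ fun k =>
    IsSplitEpi.id (S.π.f k)⟩
  obtain rfl : i + 1 = j := hij
  obtain hi | hi := lt_or_ge i m
  · exact (isZero_truncCoboundaries_quotient_X hi).eq_of_src _ _
  rw [← cancel_epi (S.π.f i)]
  ext x
  have hx : (P.d i (i + 1)).hom ((s i).hom ((S.π.f i).hom x) - x) = 0 :=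
    (S.d_mem i _ (hs i x)).2 (by lia)
  have hdx := (hs (i + 1) ((P.d i (i + 1)).hom x)).2 (by lia)
  rw [map_sub, sub_eq_zero] at hx
  exact hx.trans (sub_eq_zero.1 hdx).symm

lemma isPureExact_kernel_truncCoboundaries_π (h : ∀ k < m, TensorExactAt P k)
    [IsSplitEpi (truncCoboundaries P m).π] : IsPureExact (kernel (truncCoboundaries P m).π) := by
  let ρ := retractKernel (truncCoboundaries P m).π
  refine isPureExact_iff_tensorExactAt.2 fun k => ?_
  obtain hk | hk := lt_or_ge k m
  · exact (h k hk).of_homotopy ρ.i ρ.r (.ofEq ρ.retract)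
  intro p q a x b _
  have hx (s : Fin p) : ∃ z, ((kernel (truncCoboundaries P m).π).d (k - 1) k).hom z = x s := by
    obtain ⟨z, hz⟩ := ((π_eq_zero_iff _ ((ρ.i.f k).hom (x s))).1
      congr(($(kernel.condition (truncCoboundaries P m).π).f k).hom (x s))).1 hk
    refine ⟨(ρ.r.f (k - 1)).hom z, ?_⟩
    rw [hom_comm_apply, hz]
    exact congr(($(ρ.retract).f k).hom (x s))
  choose z hz using hx
  exact ⟨0, z, fun s => by simp [hz]⟩

lemma isContractible_of_isPureExact
    (hP : pureKProjective R ((HomotopyCategory.quotient _ _).obj P)) (h : IsPureExact P) :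
    IsContractible P :=
  pureKProjective_iff.1 hP P h (𝟙 P)

lemma pureKProjective_of_retract {Q : CochainComplex (ModuleCat.{v} R) ℤ}
    (hP : pureKProjective R ((HomotopyCategory.quotient _ _).obj P)) (r : Retract Q P) :
    pureKProjective R ((HomotopyCategory.quotient _ _).obj Q) := fun E f hE => by
  let r' := r.map (HomotopyCategory.quotient (ModuleCat.{v} R) (.up ℤ))
  rw [← Category.id_comp f, ← r'.retract, Category.assoc, hP (r'.r ≫ f) hE, comp_zero]

/-- The summands are the quotient of `P` by `truncCoboundaries P m` and that subcomplex itself. -/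
lemma exists_iso_biprod_of_isPureProjective_cokernel
    (hP : pureKProjective R ((HomotopyCategory.quotient _ _).obj P))
    (h : ∀ k < m, TensorExactAt P k) (hC : IsPureProjective (cokernel (P.d (m - 1) m))) :
    ∃ P₁ P₂ : CochainComplex (ModuleCat.{v} R) ℤ, Nonempty (P ≅ P₁ ⊞ P₂) ∧
      (∀ i, i < m → IsZero (P₁.X i)) ∧ IsContractible P₂ := by
  have := isSplitEpi_truncCoboundaries_π
    (isSplitEpi_truncCoboundaries_π_f (h (m - 1) (sub_one_lt m)) hC)
  exact ⟨_, _, ⟨biprodKernelIso (truncCoboundaries P m).π⟩,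
    fun _ => isZero_truncCoboundaries_quotient_X, isContractible_of_isPureExact
      (pureKProjective_of_retract hP (retractKernel _)) (isPureExact_kernel_truncCoboundaries_π h)⟩

end Splitting

/-! ### Pure projective dimension -/

section Dimension

variable {R : Type u} [Ring R] {X Y : CochainComplex (ModuleCat.{u} R) ℤ} {n : ℤ}

lemma PPDLE.isZero_pext (h : PPDLE X n) {i : ℤ}
    (hi : ((n : ℝ) : EReal) + supP Y < ((i : ℝ) : EReal)) : IsZero (Pext i X Y) := by
  obtain ⟨ρ, hρ⟩ := h
  exact (isZero_pext_iff ρ i).2 (mem_coboundaries_of_isZero ρ.pureKProjective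
    ρ.isPureProjective hρ fun _ hk => homExactAt_of_add_supP_lt hi hk)

lemma add_supP_stalk_lt {i : ℤ} (hi : n < i) (N : ModuleCat.{u} R) :
    ((n : ℝ) : EReal) + supP (stalk N) < ((i : ℝ) : EReal) :=
  calc ((n : ℝ) : EReal) + supP (stalk N) ≤ ((n : ℝ) : EReal) + 0 := by
        gcongr
        exact supP_stalk_le N
    _ < ((i : ℝ) : EReal) := by
        rw [add_zero, EReal.coe_lt_coe_iff]
        exact_mod_cast hi

lemma le_infP_of_isZero_pext (ρ : PureProjRes X)
    (h : ∀ (N : ModuleCat.{u} R) (i : ℤ), n < i → IsZero (Pext i X (stalk N))) :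
    (((-n : ℤ) : ℝ) : EReal) ≤ infP X := by
  refine (le_infP_iff _).2 fun k hk => ρ.isPureQuasiIso.tensorExactAt_target ?_
  obtain ⟨g, hg⟩ := exists_d_comp_eq_cokernel_π (P := ρ.P) (add_neg_cancel k)
    (sub_add_cancel k 1) rfl ((isZero_pext_iff ρ _).1 (h _ (-k) (by lia)))
  exact tensorExactAt_of_d_comp_eq g hg

lemma PureProjRes.isPureProjective_cokernel (ρ : PureProjRes X)
    (h : ∀ N : ModuleCat.{u} R, IsZero (Pext (n + 1) X (stalk N))) :
    IsPureProjective (cokernel (ρ.P.d (-n - 1) (-n))) := by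
  obtain ⟨g, hg⟩ := exists_d_comp_eq_cokernel_π (P := ρ.P) (i := -n - 2) (j := -n - 1) (k := -n)
    (n := n + 1) (by lia) (by lia) (by lia) ((isZero_pext_iff ρ _).1 (h _))
  exact isPureProjective_cokernel_of_d_comp_eq (ρ.isPureProjective _) g hg

lemma PureProjRes.exists_iso_biprod (ρ : PureProjRes X)
    (hX : (((-n : ℤ) : ℝ) : EReal) ≤ infP X)
    (hC : IsPureProjective (cokernel (ρ.P.d (-n - 1) (-n)))) :
    ∃ P₁ P₂ : CochainComplex (ModuleCat.{u} R) ℤ, Nonempty (ρ.P ≅ P₁ ⊞ P₂) ∧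
      (∀ i, i < -n → IsZero (P₁.X i)) ∧ IsContractible P₂ :=
  exists_iso_biprod_of_isPureProjective_cokernel ρ.pureKProjective
    (fun k hk => ρ.isPureQuasiIso.tensorExactAt_source ((le_infP_iff _).1 hX k hk)) hC

lemma isIso_map_biprod_inl {C D : Type*} [Category* C] [Preadditive C] [HasBinaryBiproducts C]
    [Category* D] [Preadditive D] (F : C ⥤ D) [F.Additive] {A B : C} (hB : IsZero (F.obj B)) :
    IsIso (F.map (biprod.inl : A ⟶ A ⊞ B)) := by
  refine ⟨F.map biprod.fst, by rw [← F.map_comp, biprod.inl_fst, F.map_id], ?_⟩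
  calc F.map biprod.fst ≫ F.map biprod.inl
      = F.map (biprod.fst ≫ biprod.inl) + F.map biprod.snd ≫ F.map biprod.inr := by
        rw [F.map_comp, hB.eq_of_tgt (F.map biprod.snd) 0, zero_comp, add_zero]
    _ = 𝟙 _ := by rw [← F.map_comp, ← F.map_add, biprod.total, F.map_id]

lemma PureProjRes.ppdle_of_iso_biprod (ρ : PureProjRes X)
    {P₁ P₂ : CochainComplex (ModuleCat.{u} R) ℤ} (e : ρ.P ≅ P₁ ⊞ P₂)
    (hP₁ : ∀ i, i < -n → IsZero (P₁.X i)) (hP₂ : IsContractible P₂) : PPDLE X n := by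
  let q := HomotopyCategory.quotient (ModuleCat.{u} R) (.up ℤ)
  let r : Retract P₁ ρ.P :=
    { i := biprod.inl ≫ e.inv
      r := e.hom ≫ biprod.fst
      retract := by rw [Category.assoc, e.inv_hom_id_assoc, biprod.inl_fst] }
  have hq : IsZero (q.obj P₂) := (IsZero.iff_id_eq_zero _).2
    (by rw [← q.map_id, (HomotopyCategory.quotient_map_eq_zero_iff _).2 hP₂])
  have := isIso_map_biprod_inl q (A := P₁) hq
  have hi : IsIso (q.map r.i) := by
    rw [q.map_comp]
    infer_instance
  refine ⟨.ofTrW P₁ (r.i ≫ ρ.f) ?_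
    (fun i => (ρ.isPureProjective i).of_retract (r.map (HomologicalComplex.eval _ _ i)))
    (pureKProjective_of_retract ρ.pureKProjective r), hP₁⟩
  rw [Functor.map_comp]
  exact (MorphismProperty.cancel_left_of_respectsIso _ _ _).2
    ((isPureQuasiIso_iff_trW ρ.f).1 ρ.isPureQuasiIso)

end Dimension

end PureDerived

end

theorem theorem4p5_general {R : Type u} [Ring R] (X : CochainComplex (ModuleCat.{u} R) ℤ)
    (hX : Nonempty (PureDerived.PureProjRes X)) (n : ℤ) :
    List.TFAE [
      PureDerived.PPDLE X n,
      (((-n : ℤ) : ℝ) : EReal) ≤ PureDerived.infP X ∧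
        ∀ ρ : PureDerived.PureProjRes X,
          PureDerived.IsPureProjective (cokernel (ρ.P.d (-n - 1) (-n))),
      ∀ ρ : PureDerived.PureProjRes X,
        ∃ P₁ P₂ : CochainComplex (ModuleCat.{u} R) ℤ,
          Nonempty (ρ.P ≅ P₁ ⊞ P₂) ∧ (∀ i : ℤ, i < -n → IsZero (P₁.X i)) ∧
            PureDerived.IsContractible P₂,
      ∀ (Y : CochainComplex (ModuleCat.{u} R) ℤ) (i : ℤ),
        ((n : ℝ) : EReal) + PureDerived.supP Y < ((i : ℝ) : EReal) →
          IsZero (PureDerived.Pext i X Y),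
      (((-n : ℤ) : ℝ) : EReal) ≤ PureDerived.infP X ∧
        ∀ N : ModuleCat.{u} R, IsZero (PureDerived.Pext (n + 1) X (PureDerived.stalk N))] := by
  obtain ⟨ρ⟩ := hX
  tfae_have 1 → 4 := fun h _ _ => h.isZero_pext
  tfae_have 4 → 5 := fun h =>
    have hstalk (N : ModuleCat.{u} R) (i : ℤ) (hi : n < i) :=
      h _ i (PureDerived.add_supP_stalk_lt hi N)
    ⟨PureDerived.le_infP_of_isZero_pext ρ hstalk, fun N => hstalk N (n + 1) (lt_add_one n)⟩
  tfae_have 5 → 2 := fun h => ⟨h.1, fun σ => σ.isPureProjective_cokernel h.2⟩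
  tfae_have 2 → 3 := fun h σ => σ.exists_iso_biprod h.1 (h.2 σ)
  tfae_have 3 → 1 := fun h =>
    have ⟨_, _, ⟨e⟩, hP₁, hP₂⟩ := h ρ
    ρ.ppdle_of_iso_biprod e hP₁ hP₂
  tfae_finish

theorem theorem4p5 {R : Type u} [Ring R] (X : CochainComplex (ModuleCat.{u} R) ℤ)
    (hX : PureDerived.InDbPur X) (n : ℤ) :
    List.TFAE [
      PureDerived.PPDLE X n,
      (((-n : ℤ) : ℝ) : EReal) ≤ PureDerived.infP X ∧
        ∀ ρ : PureDerived.PureProjRes X,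
          PureDerived.IsPureProjective (cokernel (ρ.P.d (-n - 1) (-n))),
      ∀ ρ : PureDerived.PureProjRes X,
        ∃ P₁ P₂ : CochainComplex (ModuleCat.{u} R) ℤ,
          Nonempty (ρ.P ≅ P₁ ⊞ P₂) ∧ (∀ i : ℤ, i < -n → IsZero (P₁.X i)) ∧
            PureDerived.IsContractible P₂,
      ∀ (Y : CochainComplex (ModuleCat.{u} R) ℤ) (i : ℤ),
        ((n : ℝ) : EReal) + PureDerived.supP Y < ((i : ℝ) : EReal) →
          IsZero (PureDerived.Pext i X Y),
      (((-n : ℤ) : ℝ) : EReal) ≤ PureDerived.infP X ∧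
        ∀ N : ModuleCat.{u} R, IsZero (PureDerived.Pext (n + 1) X (PureDerived.stalk N))] :=
  theorem4p5_general X hX.nonempty_pureProjRes n
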